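/- Let $f,g_1,\dots,g_p:\mathbb R^n\to\mathbb R^n$ and $h=(h_1,\dots,h_p):\mathbb R^n\to\mathbb R^p$ be smooth, and consider the system $$\dot x=f(x)+\sum_{i=1}^p u_i\,g_i(x),\quad y=h(x),\quad x(0)=x_0,\qquad\text{and the exosystem}\qquad \dot w=Sw,\quad r=Hw,\quad w(0)=w_0\in\mathbb R^m .$$ Write $L_X\varphi$ for the Lie derivative of $\varphi$ along $X$. Let $U\subseteq\mathbb R^n$ be an open set containing the origin and $x_0$, let $\gamma_1,\dots,\gamma_p\ge 1$, $\gamma=\sum_j\gamma_j$, and let $T=(\eta,\xi)$ be a smooth diffeomorphism from $U$ onto an open subset of $\mathbb R^{n-\gamma}\times\mathbb R^{\gamma}$, with $T(0)=0$, $\frac{\partial\eta}{\partial x}g_i=0$ on $U$ for all $i$, and $\xi=(\xi^1,\dots,\xi^p)$, $\xi^j=(h_j,L_fh_j,\dots,L_f^{\gamma_j-1}h_j)$. Assume: 1. $f(0)=0$. 2. The system has vector relative degree $(\gamma_1,\dots,\gamma_p)$ on $U$: for all $i,j$ and $0\le k\le\gamma_j-2$ one has $L_{g_i}L_f^kh_j=0$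 on $U$, and the matrix $A(x)=\big(L_{g_i}L_f^{\gamma_j-1}h_j(x)\big)_{j,i}$ is nonsingular for every $x\in U$. 3. The zero dynamics are stable: $\eta=0$ is a (locally) asymptotically stable equilibrium of $\dot\eta=f_o(\eta,0)$, where $f_o(\eta,\xi)=\frac{\partial\eta}{\partial x}f$ evaluated at $T^{-1}(\eta,\xi)$. For each $j$ let $(A_j,B_j,C_j)$ be the chain of $\gamma_j$ integrators ($A_j$ has ones on the superdiagonal and zeros elsewhere, $B_j$ is the last unit column, $C_j$ the first unit row). Let $H_j$ be the $j$-th row of $H$, suppose that $\Pi_j,\Gamma_j$ satisfy $$\Pi_jS=A_j\Pi_j+B_j\Gamma_j,\qquad C_j\Pi_j=H_j,$$ and put $\tilde\xi_0^j=\xi^j(x_0)-\Pi_jw_0$. Let $\mathcal L_j=\{\lambda^j_1<\dots<\lambda^j_{\gamma_j}\}$ with $\lambda^j_{\gamma_j}<0$, let $v^j_i\in\mathbb R^{\gamma_j}$, $\omega^j_i\in\mathbb R$ solve $$\begin{pmatrix}A_j-\lambda^j_iI&B_j\\ C_j&0\end{pmatrix}\begin{pmatrix}v^j_i\\ \omega^j_i\end{pmatrix}=\begin{pmatrix}0\\1\end{pmatrix},$$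 let $V_j=[v^j_1\cdots v^j_{\gamma_j}]$, $W_j=[\omega^j_1\cdots\omega^j_{\gamma_j}]$, and $\alpha=\alpha^j=V_j^{-1}\tilde\xi_0^j$. With $N=\gamma_j$, and $c_k=1$ if $\alpha_k\alpha_N<0$, $c_k=0$ otherwise ($1\le k\le N-1$), assume $$p(\tilde\xi_0^j,\mathcal L_j)=|\alpha_N|+(1-c_{N-1})|\alpha_{N-1}|-\sum_{k=1}^{N-1}c_k|\alpha_k|>0$$ (for $N=1$ this reads $|\alpha_1|>0$), and, if $N\ge 3$, also $\alpha_N\neq0$. Put $F_j=W_jV_j^{-1}$, $G_j=\Gamma_j-F_j\Pi_j$, $v_j=F_j\xi^j+G_jw$ for $j=1,\dots,p$ (that is, $v=F\xi+Gw$ with $F=\operatorname{blkdiag}(F_1,\dots,F_p)$ and $G$ with rows $G_1,\dots,G_p$), and apply the feedback linearizing law $$u=-A(x)^{-1}\big(L_f^{\gamma_1}h_1(x),\dots,L_f^{\gamma_p}h_p(x)\big)^{T}+A(x)^{-1}v .$$ Then this law achieves nonovershooting output regulation from $(x_0,w_0)$, in the following sense, where $e=r-y$ and the closed loop is considered on $U$: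 * (stabilization) with $w=0$, the origin is a (locally) asymptotically stable equilibrium of the closed loop; * (no overshoot) on every interval $[0,\tau)$, $0<\tau\le\infty$, on which the closed-loop response from $(x_0,w_0)$ exists in $U$, each component $e_j$ is either everywhere positive or everywhere negative; * (tracking) if the response exists in $U$ for all $t\ge0$, then $e_j(t)\to0$ as $t\to\infty$ for every $j$; * (continuation) the response exists in $U$ for all $t\ge0$, unless it leaves every compact subset of $U$. -/

import Mathlib

open Set Filter Topology
open scoped Matrix ContDiff

noncomputable section

namespace NonovershootingRegulation

/-! ### Asymptotic stability of an equilibrium of an autonomous vector field -/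

/-- `x` is a solution of `ẋ = X(x)` on `[0, ∞)` that stays in `Ω`. -/
def IsGlobalSolution {E : Type*} [NormedAddCommGroup E] [NormedSpace ℝ E]
    (X : E → E) (Ω : Set E) (x : ℝ → E) : Prop :=
  ∀ t ∈ Ici (0 : ℝ), x t ∈ Ω ∧ HasDerivWithinAt x (X (x t)) (Ici 0) t

/-- The point `z₀` is a (locally) asymptotically stable equilibrium of `ẋ = X(x)` on `Ω`:
it is an equilibrium; solutions that start near `z₀` exist for all `t ≥ 0` and stay near `z₀`;
and solutions that start near `z₀` converge to `z₀`. -/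
def IsAsymptoticallyStable {E : Type*} [NormedAddCommGroup E] [NormedSpace ℝ E]
    (X : E → E) (Ω : Set E) (z₀ : E) : Prop :=
  z₀ ∈ Ω ∧ X z₀ = 0 ∧
  (∀ N ∈ 𝓝 z₀, ∃ M ∈ 𝓝 z₀, ∀ z ∈ M,
    (∃ x : ℝ → E, x 0 = z ∧ IsGlobalSolution X Ω x) ∧
    (∀ x : ℝ → E, x 0 = z → IsGlobalSolution X Ω x → ∀ t ∈ Ici (0 : ℝ), x t ∈ N)) ∧
  (∃ M ∈ 𝓝 z₀, ∀ x : ℝ → E, x 0 ∈ M → IsGlobalSolution X Ω x → Tendsto x atTop (𝓝 z₀))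

/-! ### Affine square systems, relative degree, and the chain-of-integrators normal form -/

/-- A smooth affine system `ẋ = f(x) + ∑ᵢ uᵢ gᵢ(x)`, `yⱼ = hⱼ(x)` with state in `ℝⁿ` and with
`p` inputs and `p` outputs. -/
structure AffineSystem (n p : ℕ) where
  f : (Fin n → ℝ) → (Fin n → ℝ)
  g : Fin p → (Fin n → ℝ) → (Fin n → ℝ)
  h : Fin p → (Fin n → ℝ) → ℝ
  smooth_f : ContDiff ℝ ∞ f
  smooth_g : ∀ i, ContDiff ℝ ∞ (g i)
  smooth_h : ∀ j, ContDiff ℝ ∞ (h j)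

/-- The Lie derivative `L_X φ` of a function `φ` along a vector field `X`. -/
def lieDeriv {n : ℕ} (X : (Fin n → ℝ) → (Fin n → ℝ)) (φ : (Fin n → ℝ) → ℝ) :
    (Fin n → ℝ) → ℝ :=
  fun x => fderiv ℝ φ x (X x)

namespace AffineSystem

variable {n p : ℕ} (sys : AffineSystem n p)

/-- `L_f^k h_j`. -/
def outputLie (k : ℕ) (j : Fin p) : (Fin n → ℝ) → ℝ :=
  (lieDeriv sys.f)^[k] (sys.h j)

/-- The decoupling matrix: its `(j, i)` entry is `L_{g_i} L_f^{γ_j - 1} h_j`. -/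
def decoupling (γ : Fin p → ℕ) (x : Fin n → ℝ) : Matrix (Fin p) (Fin p) ℝ :=
  Matrix.of fun j i => lieDeriv (sys.g i) (sys.outputLie (γ j - 1) j) x

/-- The system has vector relative degree `(γ_1, …, γ_p)` on the set `U`. -/
structure HasRelativeDegree (γ : Fin p → ℕ) (U : Set (Fin n → ℝ)) : Prop where
  pos : ∀ j, 1 ≤ γ j
  vanish : ∀ (j i : Fin p) (k : ℕ), k + 2 ≤ γ j → ∀ x ∈ U,
    lieDeriv (sys.g i) (sys.outputLie k j) x = 0
  nonsingular : ∀ x ∈ U, (sys.decoupling γ x).det ≠ 0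

/-- `ξ = (ξ^1, …, ξ^p)` with `ξ^j = (h_j, L_f h_j, …, L_f^{γ_j - 1} h_j)`. -/
def chainCoord (γ : Fin p → ℕ) (x : Fin n → ℝ) : (j : Fin p) → Fin (γ j) → ℝ :=
  fun j k => sys.outputLie k j x

/-- A change of coordinates `x ↦ (η, ξ)` that brings the system into normal form: a smooth
diffeomorphism from an open set (`T.source`) onto an open set (`T.target`) whose second component
is `chainCoord` and whose first component satisfies `(∂η/∂x) g = 0`. -/
structure NormalCoordinates (γ : Fin p → ℕ) where
  T : OpenPartialHomeomorph (Fin n → ℝ)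
    ((Fin (n - ∑ j, γ j) → ℝ) × ((j : Fin p) → Fin (γ j) → ℝ))
  smooth : ContDiffOn ℝ ∞ T T.source
  smooth_symm : ContDiffOn ℝ ∞ T.symm T.target
  snd_eq : ∀ x ∈ T.source, (T x).2 = sys.chainCoord γ x
  fst_inv : ∀ x ∈ T.source, ∀ i, fderiv ℝ (fun y => (T y).1) x (sys.g i x) = 0

variable {sys} in
/-- The vector field `f_o` of the internal dynamics `η̇ = f_o(η, ξ)` in the normal form. -/
def NormalCoordinates.internalField {γ : Fin p → ℕ} (c : sys.NormalCoordinates γ)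
    (z : (Fin (n - ∑ j, γ j) → ℝ) × ((j : Fin p) → Fin (γ j) → ℝ)) :
    Fin (n - ∑ j, γ j) → ℝ :=
  fderiv ℝ (fun y => (c.T y).1) (c.T.symm z) (sys.f (c.T.symm z))

variable {sys} in
/-- The zero dynamics `η̇ = f_o(η, 0)` has an asymptotically stable equilibrium at `η = 0`. -/
def NormalCoordinates.ZeroDynamicsStable {γ : Fin p → ℕ} (c : sys.NormalCoordinates γ) : Prop :=
  IsAsymptoticallyStable (fun η => c.internalField (η, 0)) {η | (η, 0) ∈ c.T.target} 0

/-- The feedback linearizing law `u = -A(x)⁻¹ (L_f^{γ_j} h_j)_j + A(x)⁻¹ v`. -/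
def linearizingInput (γ : Fin p → ℕ) (x : Fin n → ℝ) (v : Fin p → ℝ) : Fin p → ℝ :=
  -((sys.decoupling γ x)⁻¹ *ᵥ fun j => sys.outputLie (γ j) j x) + (sys.decoupling γ x)⁻¹ *ᵥ v

/-- The right-hand side of the state equation under a feedback law `u = u(x, w)`. -/
def closedLoop {m : ℕ} (u : (Fin n → ℝ) → (Fin m → ℝ) → (Fin p → ℝ))
    (x : Fin n → ℝ) (w : Fin m → ℝ) : Fin n → ℝ :=
  sys.f x + ∑ i, u x w i • sys.g i x

/-- `(x, w)` solves the system under the feedback `u = u(x, w)` together with the exosystem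
`ẇ = S w` on the time interval `J`, with initial value `(x₀, w₀)`, and `x` stays in `U`. -/
structure IsResponse {m : ℕ} (u : (Fin n → ℝ) → (Fin m → ℝ) → (Fin p → ℝ))
    (S : Matrix (Fin m) (Fin m) ℝ) (U : Set (Fin n → ℝ)) (x₀ : Fin n → ℝ) (w₀ : Fin m → ℝ)
    (J : Set ℝ) (x : ℝ → Fin n → ℝ) (w : ℝ → Fin m → ℝ) : Prop where
  init_x : x 0 = x₀
  init_w : w 0 = w₀
  mem : ∀ t ∈ J, x t ∈ U
  deriv_x : ∀ t ∈ J, HasDerivWithinAt x (sys.closedLoop u (x t) (w t)) J t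
  deriv_w : ∀ t ∈ J, HasDerivWithinAt w (S *ᵥ w t) J t

/-- The `j`-th component of the tracking error `e = r - y`, where `r = H w` and `y = h(x)`. -/
def trackingError {m : ℕ} (H : Matrix (Fin p) (Fin m) ℝ) (x : ℝ → Fin n → ℝ)
    (w : ℝ → Fin m → ℝ) (j : Fin p) (t : ℝ) : ℝ :=
  (H *ᵥ w t) j - sys.h j (x t)

/-- The feedback `u = u(x, w)`, used on the domain `U`, achieves nonovershooting output regulation
from `(x₀, w₀)`:
* with `w = 0` the origin is an asymptotically stable equilibrium of the closed loop;
* on every interval `[0, τ)` on which the response from `(x₀, w₀)` exists in `U`, every error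
  component keeps a constant (strict) sign;
* whenever the response exists in `U` for all `t ≥ 0`, every error component tends to `0` and
  keeps a constant (strict) sign;
* the response exists in `U` for all `t ≥ 0` unless it leaves every compact subset of `U`. -/
structure AchievesNonovershootingRegulation {m : ℕ}
    (u : (Fin n → ℝ) → (Fin m → ℝ) → (Fin p → ℝ))
    (S : Matrix (Fin m) (Fin m) ℝ) (H : Matrix (Fin p) (Fin m) ℝ) (U : Set (Fin n → ℝ))
    (x₀ : Fin n → ℝ) (w₀ : Fin m → ℝ) : Prop where
  stable : IsAsymptoticallyStable (fun x => sys.closedLoop u x 0) U 0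
  sign : ∀ τ > 0, ∀ x w, sys.IsResponse u S U x₀ w₀ (Ico 0 τ) x w → ∀ j,
    (∀ t ∈ Ico 0 τ, 0 < sys.trackingError H x w j t) ∨
    (∀ t ∈ Ico 0 τ, sys.trackingError H x w j t < 0)
  tracking : ∀ x w, sys.IsResponse u S U x₀ w₀ (Ici 0) x w → ∀ j,
    Tendsto (sys.trackingError H x w j) atTop (𝓝 0) ∧
    ((∀ t ∈ Ici (0 : ℝ), 0 < sys.trackingError H x w j t) ∨
     (∀ t ∈ Ici (0 : ℝ), sys.trackingError H x w j t < 0))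
  continuation : (∃ x w, sys.IsResponse u S U x₀ w₀ (Ici 0) x w) ∨
    ∀ K ⊆ U, IsCompact K →
      ∃ τ ≥ 0, ∃ x w, sys.IsResponse u S U x₀ w₀ (Icc 0 τ) x w ∧ x τ ∉ K

end AffineSystem

/-! ### Chains of integrators, Moore's method and the sign test -/

/-- State matrix of the chain of `n` integrators: ones on the superdiagonal. -/
def chainA (n : ℕ) : Matrix (Fin n) (Fin n) ℝ :=
  Matrix.of fun i k => if (k : ℕ) = i + 1 then 1 else 0

/-- Input matrix of the chain of `n` integrators: the last unit column. -/
def chainB (n : ℕ) : Matrix (Fin n) (Fin 1) ℝ :=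
  Matrix.of fun i _ => if (i : ℕ) + 1 = n then 1 else 0

/-- Output matrix of the chain of `n` integrators: the first unit row. -/
def chainC (n : ℕ) : Matrix (Fin 1) (Fin n) ℝ :=
  Matrix.of fun _ k => if (k : ℕ) = 0 then 1 else 0

/-- The Rosenbrock equation `[A - l I, B; C, 0] (v, b) = (0, 1)` of the chain of integrators. -/
def Rosenbrock {n : ℕ} (l : ℝ) (v : Fin n → ℝ) (b : ℝ) : Prop :=
  Matrix.fromBlocks (chainA n - l • 1) (chainB n) (chainC n) 0 *ᵥ Sum.elim v (fun _ => b) =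
    Sum.elim (fun _ => 0) (fun _ => 1)

/-- `V = [v_1 ⋯ v_n]`, the matrix with columns `v i`. -/
def eigMatrix {n : ℕ} (v : Fin n → Fin n → ℝ) : Matrix (Fin n) (Fin n) ℝ :=
  Matrix.of fun r i => v i r

/-- Moore's feedback matrix `F = W V⁻¹` with `W = [b_1 ⋯ b_n]`. -/
def mooreGain {n : ℕ} (v : Fin n → Fin n → ℝ) (b : Fin n → ℝ) : Matrix (Fin 1) (Fin n) ℝ :=
  (Matrix.of fun _ i => b i) * (eigMatrix v)⁻¹

/-- The modal coordinates `α = V⁻¹ z`. -/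
def modal {n : ℕ} (v : Fin n → Fin n → ℝ) (z : Fin n → ℝ) : Fin n → ℝ :=
  (eigMatrix v)⁻¹ *ᵥ z

/-- The entries of `α` numbered `1, …, n` (and `0` outside this range). -/
def entry {n : ℕ} (α : Fin n → ℝ) (k : ℕ) : ℝ :=
  if hk : 1 ≤ k ∧ k ≤ n then α ⟨k - 1, by omega⟩ else 0

/-- `c_k = 1` if `α_k α_n < 0`, and `c_k = 0` otherwise. -/
def signFlag {n : ℕ} (α : Fin n → ℝ) (k : ℕ) : ℝ :=
  open Classical in if entry α k * entry α n < 0 then 1 else 0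

/-- `p = |α_n| + (1 - c_{n-1}) |α_{n-1}| - ∑_{k=1}^{n-1} c_k |α_k|`; for `n = 1` this is `|α_1|`. -/
def signTest {n : ℕ} (α : Fin n → ℝ) : ℝ :=
  |entry α n| + (1 - signFlag α (n - 1)) * |entry α (n - 1)|
    - ∑ k ∈ Finset.Icc 1 (n - 1), signFlag α k * |entry α k|

/-- The control law `v = F ξ + G w` with `F = blkdiag(F_1, …, F_p)` and `G` with rows
`G_1, …, G_p`; that is, `v_j = F_j ξ^j + G_j w`. -/
def auxInput {p m : ℕ} {γ : Fin p → ℕ} (F : (j : Fin p) → Matrix (Fin 1) (Fin (γ j)) ℝ)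
    (G : Fin p → Matrix (Fin 1) (Fin m) ℝ)
    (ξ : (j : Fin p) → Fin (γ j) → ℝ) (w : Fin m → ℝ) : Fin p → ℝ :=
  fun j => (F j *ᵥ ξ j) 0 + (G j *ᵥ w) 0

end NonovershootingRegulation

end

open NonovershootingRegulation

/-! In the coordinates `(η, ξ)` the feedback produces `η̇ = f_o(η, ξ)` together with decoupled
linear chains `ξ̇^j = A_j ξ^j + B_j (F_j ξ^j + G_j w)` (`fderiv_closedLoop_eq`). Everything is then
read off the normal form.

Error. Put `z^j = ξ^j - Π_j w`. The Sylvester equation removes `w` and leaves `ż^j = (A_j + B_j F_j)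
z^j`, while `C_j Π_j = H_j` makes `e_j` minus the first entry of `z^j`. By the Rosenbrock equations
the columns of `V_j` are eigenvectors of `A_j + B_j F_j` with first entry 1, so `e_j(t) = -∑ α_i
exp(λ_i t)` (`IsResponse.trackingError_eq`). Tracking follows from `λ_i < 0`. The sign is constant
because the test says that the slowest modes outweigh all modes of the opposite sign
(`sum_exp_sign_of_signTest`).

Stability. For `w = 0` the normal form is a cascade: `ξ` decays at a linear rate and drives `η`,
whose dynamics at `ξ = 0` is asymptotically stable. `isAsymptoticallyStable_cascade` uses no
Lyapunov function: over a time window of fixed length an orbit stays close to the orbit on the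
section `ξ = 0`, and successive windows are chained.

Continuation. A `C¹` flow exists as long as it stays in a compact set, and the linear exosystem
cannot blow up, so only `x` can obstruct existence. -/

namespace NonovershootingRegulation

/-! ### Autonomous differential equations: uniqueness, gluing, exit from compact sets. -/

section AutonomousODE

variable {E : Type*} [NormedAddCommGroup E] [NormedSpace ℝ E]

/-- `x` solves `ẋ = X(x)` on the time set `J`. -/
def SolvesOn (X : E → E) (J : Set ℝ) (x : ℝ → E) : Prop :=
  ∀ t ∈ J, HasDerivWithinAt x (X (x t)) J t

theorem SolvesOn.mono {X : E → E} {J J' : Set ℝ} {x : ℝ → E} (h : SolvesOn X J x)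
    (hJ : J' ⊆ J) : SolvesOn X J' x :=
  fun t ht => (h t (hJ ht)).mono hJ

theorem SolvesOn.continuousOn {X : E → E} {J : Set ℝ} {x : ℝ → E} (h : SolvesOn X J x) :
    ContinuousOn x J :=
  fun t ht => (h t ht).continuousWithinAt

theorem SolvesOn.hasDerivWithinAt_Ici {X : E → E} {T : ℝ} {x : ℝ → E}
    (h : SolvesOn X (Icc 0 T) x) {t : ℝ} (ht : t ∈ Ico 0 T) :
    HasDerivWithinAt x (X (x t)) (Ici t) t :=
  ((h t (Ico_subset_Icc_self ht)).mono (Icc_subset_Icc_left ht.1)).mono_of_mem_nhdsWithin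
    (Icc_mem_nhdsGE ht.2)

theorem SolvesOn.congr_field {X Y : E → E} {J : Set ℝ} {x : ℝ → E} (h : SolvesOn X J x)
    (hXY : ∀ t ∈ J, X (x t) = Y (x t)) : SolvesOn Y J x :=
  fun t ht => hXY t ht ▸ h t ht

theorem SolvesOn.shift {X : E → E} {x : ℝ → E} (h : SolvesOn X (Ici 0) x) {s : ℝ} (hs : 0 ≤ s) :
    SolvesOn X (Ici 0) fun t => x (s + t) := by
  intro t ht
  have h1 := h (s + t) (add_nonneg hs ht)
  have h2 : HasDerivWithinAt (fun t : ℝ => s + t) 1 (Ici 0) t :=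
    ((hasDerivAt_id t).const_add s).hasDerivWithinAt
  rw [← one_smul ℝ (X (x (s + t)))]
  exact h1.scomp t h2 (fun r hr => add_nonneg hs hr)

theorem SolvesOn.dist_le {X : E → E} {K : NNReal} (hX : LipschitzWith K X) {T : ℝ} {x y : ℝ → E}
    (hx : SolvesOn X (Icc 0 T) x) (hy : SolvesOn X (Icc 0 T) y) :
    ∀ t ∈ Icc 0 T, dist (x t) (y t) ≤ dist (x 0) (y 0) * Real.exp (K * t) := by
  intro t ht
  have := dist_le_of_trajectories_ODE (v := fun _ => X) (fun _ => hX) hx.continuousOn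
    (fun t ht => hx.hasDerivWithinAt_Ici ht) hy.continuousOn
    (fun t ht => hy.hasDerivWithinAt_Ici ht) le_rfl t ht
  simpa using this

theorem SolvesOn.eqOn_of_lipschitzWith {X : E → E} {K : NNReal} (hX : LipschitzWith K X) {T : ℝ}
    {x y : ℝ → E} (hx : SolvesOn X (Icc 0 T) x) (hy : SolvesOn X (Icc 0 T) y) (h0 : x 0 = y 0) :
    EqOn x y (Icc 0 T) := by
  intro t ht
  have := hx.dist_le hX hy t ht
  rw [h0, dist_self, zero_mul] at this
  exact dist_le_zero.1 this

/-- Solutions on all intervals `[0, T]` glue to a solution on `[0, ∞)` if they are unique. -/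
theorem exists_solvesOn_Ici {X : E → E} {Ω : Set E} {z₀ : E}
    (hex : ∀ T, 0 ≤ T → ∃ x, x 0 = z₀ ∧ SolvesOn X (Icc 0 T) x ∧ ∀ t ∈ Icc 0 T, x t ∈ Ω)
    (huniq : ∀ T x y, SolvesOn X (Icc 0 T) x → SolvesOn X (Icc 0 T) y →
      (∀ t ∈ Icc 0 T, x t ∈ Ω) → (∀ t ∈ Icc 0 T, y t ∈ Ω) → x 0 = y 0 → EqOn x y (Icc 0 T)) :
    ∃ x, x 0 = z₀ ∧ SolvesOn X (Ici 0) x ∧ ∀ t ∈ Ici (0 : ℝ), x t ∈ Ω := by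
  choose y hy0 hysol hyΩ using fun k : ℕ => hex k k.cast_nonneg
  have hagree : ∀ k l : ℕ, k ≤ l → EqOn (y k) (y l) (Icc 0 k) := fun k l hkl => by
    have hsub : Icc (0 : ℝ) k ⊆ Icc 0 l := Icc_subset_Icc_right (by exact_mod_cast hkl)
    exact huniq k _ _ (hysol k) ((hysol l).mono hsub) (hyΩ k) (fun t ht => hyΩ l t (hsub ht))
      ((hy0 k).trans (hy0 l).symm)
  have hagree' : ∀ k l : ℕ, ∀ t : ℝ, 0 ≤ t → t ≤ k → t ≤ l → y k t = y l t := by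
    intro k l t h0 hk hl
    rcases le_total k l with h | h
    · exact hagree k l h ⟨h0, hk⟩
    · exact (hagree l k h ⟨h0, hl⟩).symm
  -- By `hagree'` every integer horizon beyond `t` gives the same value; the ceiling merely selects
  -- one.
  let x : ℝ → E := fun t => y ⌈t⌉₊ t
  have hx : ∀ k : ℕ, EqOn x (y k) (Icc 0 k) := fun k t ht =>
    hagree' _ _ t ht.1 (Nat.le_ceil t) ht.2
  refine ⟨x, (hx 0 (by simp)).trans (hy0 0), fun t ht => ?_, fun t ht => ?_⟩
  · obtain ⟨k, hk⟩ := exists_nat_gt t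
    have ht' : t ∈ Icc (0 : ℝ) k := ⟨ht, hk.le⟩
    have h1 : HasDerivWithinAt x (X (x t)) (Icc 0 k) t := by
      rw [hx k ht']
      exact (hysol k t ht').congr (hx k) (hx k ht')
    refine h1.mono_of_mem_nhdsWithin ?_
    rw [← Ici_inter_Iic]
    exact inter_mem_nhdsWithin _ (Iic_mem_nhds hk)
  · obtain ⟨k, hk⟩ := exists_nat_gt t
    have ht' : t ∈ Icc (0 : ℝ) k := ⟨ht, hk.le⟩
    rw [hx k ht']
    exact hyΩ k t ht'

/-- With speed at most `B`, a solution on `[0, T]` cannot leave the ball of radius `B * T`, so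
Picard–Lindelöf applies for every `T`, not only for small ones. -/
theorem exists_solvesOn_Ici_of_lipschitzWith [CompleteSpace E] {X : E → E} {K : NNReal}
    (hX : LipschitzWith K X) {B : ℝ} (hB : ∀ z, ‖X z‖ ≤ B) (z₀ : E) :
    ∃ x, x 0 = z₀ ∧ SolvesOn X (Ici 0) x := by
  have hB0 : 0 ≤ B := (norm_nonneg _).trans (hB z₀)
  obtain ⟨x, hx0, hx, -⟩ := exists_solvesOn_Ici (X := X) (Ω := univ) (z₀ := z₀)
    (fun T hT => by
      have hpl : IsPicardLindelof (fun _ => X) (tmin := 0) (tmax := T) ⟨0, ⟨le_rfl, hT⟩⟩ z₀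
          ⟨B * T, by positivity⟩ 0 ⟨B, hB0⟩ K :=
        IsPicardLindelof.of_time_independent (fun z _ => hB z) hX.lipschitzOnWith (by
          simp only [sub_zero, sub_self, NNReal.coe_zero]
          rw [max_eq_left hT]
          exact le_rfl)
      obtain ⟨x, h0, hx⟩ := hpl.exists_eq_forall_mem_Icc_hasDerivWithinAt₀
      exact ⟨x, h0, hx, fun _ _ => mem_univ _⟩)
    (fun T x y hx hy _ _ h0 => hx.eqOn_of_lipschitzWith hX hy h0)
  exact ⟨x, hx0, hx⟩

/-- A `C¹` vector field on an open set agrees near a given compact set with a bounded, globally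
Lipschitz one. -/
theorem exists_lipschitzWith_eqOn [FiniteDimensional ℝ E] {X : E → E} {Ω K : Set E}
    (hΩ : IsOpen Ω) (hX : ContDiffOn ℝ 1 X Ω) (hK : IsCompact K) (hKΩ : K ⊆ Ω) :
    ∃ (Y : E → E) (L : NNReal) (B : ℝ) (V : Set E), LipschitzWith L Y ∧ (∀ z, ‖Y z‖ ≤ B) ∧
      IsOpen V ∧ K ⊆ V ∧ V ⊆ Ω ∧ EqOn X Y V := by
  have : ProperSpace E := FiniteDimensional.proper_real E
  obtain ⟨K', hK', hKK', hK'Ω⟩ := exists_compact_between hK hΩ hKΩ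
  obtain ⟨χ, hχ1, hχ0, -⟩ := exists_contMDiffMap_one_nhds_of_subset_interior (n := 1)
    (modelWithCornersSelf ℝ E) hK.isClosed hKK'
  have hχ : ContDiff ℝ 1 χ := χ.contMDiff.contDiff
  -- Nothing is known about `X` off `Ω`, but `χ` vanishes outside the compact set `K' ⊆ Ω`, so the
  -- product is `C¹` with compact support.
  let Y : E → E := fun z => χ z • X z
  have hY : ContDiff ℝ 1 Y := by
    rw [contDiff_iff_contDiffAt]
    intro z
    by_cases hz : z ∈ Ω
    · exact hχ.contDiffAt.smul (hX.contDiffAt (hΩ.mem_nhds hz))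
    · have hz' : K'ᶜ ∈ 𝓝 z := hK'.isClosed.isOpen_compl.mem_nhds fun h => hz (hK'Ω h)
      refine (contDiffAt_const (c := (0 : E))).congr_of_eventuallyEq ?_
      filter_upwards [hz'] with y hy
      simp [Y, hχ0 y hy]
  have hsupp : HasCompactSupport Y :=
    HasCompactSupport.intro hK' fun z hz => by simp [Y, hχ0 z hz]
  obtain ⟨L, hL⟩ := hY.lipschitzWith_of_hasCompactSupport hsupp one_ne_zero
  obtain ⟨B, hB⟩ := hsupp.exists_bound_of_continuous hY.continuous
  obtain ⟨V, hV, hKV, hV1⟩ := mem_nhdsSet_iff_exists.1 hχ1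
  refine ⟨Y, L, B, V ∩ Ω, hL, hB, hV.inter hΩ, subset_inter hKV hKΩ, inter_subset_right, ?_⟩
  intro z hz
  have : χ z = 1 := hV1 hz.1
  simp [Y, this]

/-- The two trajectories together form a compact subset of `Ω`; near it the field may be replaced by
a globally Lipschitz one, to which Grönwall's inequality applies. -/
theorem SolvesOn.eqOn_of_contDiffOn [FiniteDimensional ℝ E] {X : E → E} {Ω : Set E}
    (hΩ : IsOpen Ω) (hX : ContDiffOn ℝ 1 X Ω) {T : ℝ} {x y : ℝ → E}
    (hx : SolvesOn X (Icc 0 T) x) (hy : SolvesOn X (Icc 0 T) y)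
    (hxΩ : ∀ t ∈ Icc 0 T, x t ∈ Ω) (hyΩ : ∀ t ∈ Icc 0 T, y t ∈ Ω) (h0 : x 0 = y 0) :
    EqOn x y (Icc 0 T) := by
  obtain ⟨Y, L, -, V, hL, -, -, hKV, -, hXY⟩ := exists_lipschitzWith_eqOn hΩ hX
    ((isCompact_Icc.image_of_continuousOn hx.continuousOn).union
      (isCompact_Icc.image_of_continuousOn hy.continuousOn))
    (union_subset (image_subset_iff.2 hxΩ) (image_subset_iff.2 hyΩ))
  exact (hx.congr_field fun t ht => hXY (hKV (.inl (mem_image_of_mem _ ht)))).eqOn_of_lipschitzWith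
    hL (hy.congr_field fun t ht => hXY (hKV (.inr (mem_image_of_mem _ ht)))) h0

/-- A solution that starts in a compact set `K` either stays in `K` up to time `T` or leaves `K`
before. -/
theorem exists_solvesOn_mem_or_exit [FiniteDimensional ℝ E] {X : E → E} {Ω K : Set E}
    (hΩ : IsOpen Ω) (hX : ContDiffOn ℝ 1 X Ω) (hK : IsCompact K) (hKΩ : K ⊆ Ω) {z₀ : E}
    (hz₀ : z₀ ∈ K) (T : ℝ) :
    (∃ x, x 0 = z₀ ∧ SolvesOn X (Icc 0 T) x ∧ ∀ t ∈ Icc 0 T, x t ∈ K) ∨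
    ∃ τ ∈ Icc 0 T, ∃ x, x 0 = z₀ ∧ SolvesOn X (Icc 0 τ) x ∧ (∀ t ∈ Icc 0 τ, x t ∈ Ω) ∧
      x τ ∉ K := by
  have : CompleteSpace E := FiniteDimensional.complete ℝ E
  obtain ⟨Y, L, B, V, hL, hB, hV, hKV, hVΩ, hXY⟩ := exists_lipschitzWith_eqOn hΩ hX hK hKΩ
  obtain ⟨x, hx0, hx⟩ := exists_solvesOn_Ici_of_lipschitzWith hL hB z₀
  have key : ∀ τ, (∀ t ∈ Icc 0 τ, x t ∈ V) → SolvesOn X (Icc 0 τ) x := fun τ h =>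
    (hx.mono Icc_subset_Ici_self).congr_field fun t ht => (hXY (h t ht)).symm
  by_cases hstay : ∀ t ∈ Icc 0 T, x t ∈ K
  · exact .inl ⟨x, hx0, key T fun t ht => hKV (hstay t ht), hstay⟩
  right
  by_cases hV' : ∀ t ∈ Icc 0 T, x t ∈ V
  · push Not at hstay
    obtain ⟨τ, hτ, hτK⟩ := hstay
    have hsub : ∀ t ∈ Icc 0 τ, x t ∈ V := fun t ht => hV' t ⟨ht.1, ht.2.trans hτ.2⟩
    exact ⟨τ, hτ, x, hx0, key τ hsub, fun t ht => hVΩ (hsub t ht), hτK⟩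
  · push Not at hV'
    -- The trajectory of `Y` is known to solve the original equation only inside `V`; the least
    -- element `s` of `A` is the first time at which it is outside.
    let A : Set ℝ := Icc 0 T ∩ x ⁻¹' Vᶜ
    have hA : IsCompact A := isCompact_Icc.of_isClosed_subset
      ((hx.mono Icc_subset_Ici_self).continuousOn.preimage_isClosed_of_isClosed isClosed_Icc
        hV.isClosed_compl) inter_subset_left
    obtain ⟨s, hs, hsmin⟩ := hA.exists_isLeast hV'
    have hlt : ∀ t, 0 ≤ t → t < s → x t ∈ V := fun t h0 hts => by
      by_contra hcon
      exact absurd (hsmin ⟨⟨h0, hts.le.trans hs.1.2⟩, hcon⟩) (not_le.2 hts)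
    have hs0 : 0 < s := lt_of_le_of_ne hs.1.1 fun h => hs.2 (hKV (by rwa [← h, hx0]))
    -- Since `K` is closed and `x s ∉ K`, the trajectory leaves `K` strictly before `s`, while it
    -- still solves the original equation.
    have hexit : ∃ t, 0 ≤ t ∧ t < s ∧ x t ∉ K := by
      by_contra! hcon
      have hlim : Tendsto x (𝓝[Ico 0 s] s) (𝓝 (x s)) :=
        (hx s hs.1.1).continuousWithinAt.mono_left (nhdsWithin_mono _ Ico_subset_Ici_self)
      rw [nhdsWithin_Ico_eq_nhdsLT hs0] at hlim
      refine hs.2 (hKV (hK.isClosed.mem_of_tendsto hlim ?_))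
      filter_upwards [Ico_mem_nhdsLT hs0] with t ht using hcon t ht.1 ht.2
    obtain ⟨τ, h0, hτs, hτK⟩ := hexit
    have hsub : ∀ t ∈ Icc 0 τ, x t ∈ V := fun t ht => hlt t ht.1 (ht.2.trans_lt hτs)
    exact ⟨τ, ⟨h0, hτs.le.trans hs.1.2⟩, x, hx0, key τ hsub, fun t ht => hVΩ (hsub t ht), hτK⟩

end AutonomousODE

/-! ### Asymptotic stability of cascades. -/

section Cascade

variable {E₁ E₂ : Type*} [NormedAddCommGroup E₁] [NormedAddCommGroup E₂]

/-- A semiflow on a product that is Lipschitz in the initial value, whose second component decays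
while the flow stays in the ball of radius `r`, and for which the zero section `E₁ × {0}` is
stable and attracted to the origin. -/
structure IsCascadeFlow (φ : E₁ × E₂ → ℝ → E₁ × E₂) (r L C : ℝ) (κ : ℝ → ℝ) : Prop where
  r_pos : 0 < r
  zero : ∀ z, φ z 0 = z
  add : ∀ z s t, 0 ≤ s → 0 ≤ t → φ z (s + t) = φ (φ z s) t
  lip : ∀ z z' t, 0 ≤ t → dist (φ z t) (φ z' t) ≤ dist z z' * Real.exp (L * t)
  decay : ∀ z t, 0 ≤ t → (∀ s ∈ Icc 0 t, ‖φ z s‖ ≤ r) → ‖(φ z t).2‖ ≤ κ t * ‖z.2‖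
  decay_le : ∀ t, 0 ≤ t → κ t ≤ C
  decay_lim : Tendsto κ atTop (𝓝 0)
  section_stable : ∀ ε > 0, ∃ δ > 0, ∀ η : E₁, ‖η‖ ≤ δ → ∀ t, 0 ≤ t → ‖φ (η, 0) t‖ ≤ ε
  section_attractive : ∃ δ > 0, ∀ η : E₁, ‖η‖ ≤ δ → Tendsto (φ (η, 0)) atTop (𝓝 0)

namespace IsCascadeFlow

variable {φ : E₁ × E₂ → ℝ → E₁ × E₂} {r L C : ℝ} {κ : ℝ → ℝ}

/-- The orbit is compared with that of its projection to the zero section, which starts at distance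
`‖z.2‖`. The factor `exp (L * t)` confines the use of this bound to time windows of bounded length.
-/
theorem norm_le_section (h : IsCascadeFlow φ r L C κ) (z : E₁ × E₂) {t : ℝ} (ht : 0 ≤ t) :
    ‖φ z t‖ ≤ ‖φ (z.1, 0) t‖ + ‖z.2‖ * Real.exp (L * t) := by
  have h1 := h.lip z (z.1, 0) t ht
  have h2 : dist z (z.1, 0) = ‖z.2‖ := by
    rw [dist_eq_norm, Prod.norm_def]; simp
  rw [h2, dist_eq_norm] at h1
  have := norm_sub_norm_le (φ z t) (φ (z.1, 0) t)
  linarith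

theorem section_invariant (h : IsCascadeFlow φ r L C κ) {η : E₁}
    (hη : ∀ t, 0 ≤ t → ‖φ (η, 0) t‖ ≤ r) {t : ℝ} (ht : 0 ≤ t) : (φ (η, 0) t).2 = 0 := by
  have := h.decay (η, 0) t ht fun s hs => hη s hs.1
  simpa using this

/-- The zero section is attracted to the origin uniformly on a ball. -/
theorem uniform_section_attractive [ProperSpace E₁] (h : IsCascadeFlow φ r L C κ) :
    ∃ δ₀ > 0, ∀ ε > 0, ∃ T > 0, ∀ η : E₁, ‖η‖ ≤ δ₀ → ∀ t, T ≤ t → ‖φ (η, 0) t‖ ≤ ε := by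
  obtain ⟨δ₁, hδ₁, hatt⟩ := h.section_attractive
  obtain ⟨δ₂, hδ₂, hstay⟩ := h.section_stable r h.r_pos
  refine ⟨min δ₁ δ₂, lt_min hδ₁ hδ₂, fun ε hε => ?_⟩
  obtain ⟨δ, hδ, hδε⟩ := h.section_stable ε hε
  have hpt : ∀ η ∈ Metric.closedBall (0 : E₁) (min δ₁ δ₂), ∃ t : ℝ, 0 ≤ t ∧ ‖φ (η, 0) t‖ < δ := by
    intro η hη
    rw [mem_closedBall_zero_iff] at hη
    have := (hatt η (hη.trans (min_le_left _ _))).norm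
    rw [norm_zero] at this
    obtain ⟨t, ht, ht0⟩ := ((this.eventually_lt_const hδ).and (eventually_ge_atTop 0)).exists
    exact ⟨t, ht0, ht⟩
  choose! τ hτ0 hτ using hpt
  have hcont : ∀ t, 0 ≤ t → Continuous fun η : E₁ => φ (η, 0) t := by
    intro t ht
    refine (LipschitzWith.of_dist_le_mul (K := ⟨Real.exp (L * t), (Real.exp_pos _).le⟩)
      fun η η' => ?_).continuous
    refine (h.lip (η, 0) (η', 0) t ht).trans (le_of_eq ?_)
    rw [mul_comm, Prod.dist_eq]
    simp only [dist_self, dist_nonneg, sup_of_le_left]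
    rfl
  -- Each `η` reaches the `δ`-ball at some time `τ η`, and so do its neighbours at the same time;
  -- compactness leaves finitely many such times.
  obtain ⟨s, hs, hcover⟩ := (isCompact_closedBall (0 : E₁) (min δ₁ δ₂)).elim_nhds_subcover
    (fun η => {η' | ‖φ (η', 0) (τ η)‖ < δ}) fun η hη =>
      (isOpen_lt (hcont _ (hτ0 η hη)).norm continuous_const).mem_nhds (hτ η hη)
  -- The sum of the nonnegative entry times bounds each of them; the `+ 1` only makes it positive.
  refine ⟨∑ η ∈ s, τ η + 1, add_pos_of_nonneg_of_pos
    (Finset.sum_nonneg fun η hη => hτ0 η (hs η hη)) one_pos, fun η hη t ht => ?_⟩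
  obtain ⟨η', hη', hlt⟩ := mem_iUnion₂.1 (hcover (mem_closedBall_zero_iff.2 hη))
  have hτ' := hτ0 η' (hs η' hη')
  have hle : τ η' ≤ t := by
    have := Finset.single_le_sum (fun η hη => hτ0 η (hs η hη)) hη'
    linarith
  have hinv := h.section_invariant (fun t ht => hstay η (hη.trans (min_le_right _ _)) t ht) hτ'
  -- On entering the `δ`-ball the orbit is still on the section, so the choice of `δ` traps it in
  -- the `ε`-ball from then on.
  have heq : φ (η, 0) (τ η') = ((φ (η, 0) (τ η')).1, 0) := Prod.ext rfl hinv
  have hnorm : ‖(φ (η, 0) (τ η')).1‖ ≤ δ := (norm_fst_le _).trans (le_of_lt hlt)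
  have hadd := h.add (η, 0) (τ η') (t - τ η') hτ' (sub_nonneg.2 hle)
  rw [add_sub_cancel, heq] at hadd
  rw [hadd]
  exact hδε _ hnorm _ (sub_nonneg.2 hle)

/-- If `‖z.1‖ ≤ δ₁` and `‖z.2‖ ≤ ρ`, then during a window of length `T` the orbit stays in the
`ε`-ball, and it ends in the `δ₁`-ball. The decay of the second component restores `‖z.2‖ ≤ ρ` at
each new window, so induction covers all times. -/
theorem stable [ProperSpace E₁] (h : IsCascadeFlow φ r L C κ) {ε : ℝ} (hε : 0 < ε) :
    ∃ δ > 0, ∀ z : E₁ × E₂, ‖z‖ ≤ δ → ∀ t, 0 ≤ t → ‖φ z t‖ ≤ ε := by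
  wlog hεr : ε ≤ r generalizing ε
  · obtain ⟨δ, hδ, hz⟩ := this h.r_pos le_rfl
    exact ⟨δ, hδ, fun z hzδ t ht => (hz z hzδ t ht).trans (not_le.1 hεr).le⟩
  obtain ⟨δ₀, hδ₀, hunif⟩ := h.uniform_section_attractive
  obtain ⟨δ₂, hδ₂, hsec⟩ := h.section_stable (ε / 2) (half_pos hε)
  obtain ⟨δ₁, hδ₁, hδ₁0, hδ₁2⟩ : ∃ δ₁ > 0, δ₁ ≤ δ₀ ∧ δ₁ ≤ δ₂ :=
    ⟨min δ₀ δ₂, lt_min hδ₀ hδ₂, min_le_left _ _, min_le_right _ _⟩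
  obtain ⟨T, hT, hTδ⟩ := hunif (δ₁ / 2) (half_pos hδ₁)
  -- `ρ` absorbs the growth factor over a whole window; `|L|` appears because the sign of `L` is not
  -- prescribed.
  obtain ⟨ρ, hρ, hρε, hρδ⟩ : ∃ ρ > 0, (∀ t ≤ T, 0 ≤ t → ρ * Real.exp (L * t) ≤ ε / 2) ∧
      ρ * Real.exp (L * T) ≤ δ₁ / 2 := by
    have hexp : ∀ t ≤ T, 0 ≤ t → Real.exp (L * t) ≤ Real.exp (|L| * T) := fun t ht ht0 => by
      refine Real.exp_le_exp.2 ?_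
      calc L * t ≤ |L| * t := by gcongr; exact le_abs_self L
        _ ≤ |L| * T := by gcongr
    have hm : 0 < min (ε / 2) (δ₁ / 2) := lt_min (half_pos hε) (half_pos hδ₁)
    have hρ : ∀ t ≤ T, 0 ≤ t →
        min (ε / 2) (δ₁ / 2) / Real.exp (|L| * T) * Real.exp (L * t) ≤ min (ε / 2) (δ₁ / 2) :=
      fun t ht ht0 => by
        rw [div_mul_eq_mul_div, div_le_iff₀ (Real.exp_pos _)]
        exact mul_le_mul_of_nonneg_left (hexp t ht ht0) hm.le
    exact ⟨min (ε / 2) (δ₁ / 2) / Real.exp (|L| * T), by positivity,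
      fun t ht ht0 => (hρ t ht ht0).trans (min_le_left _ _),
      (hρ T le_rfl hT.le).trans (min_le_right _ _)⟩
  have step : ∀ z : E₁ × E₂, ‖z.1‖ ≤ δ₁ → ‖z.2‖ ≤ ρ →
      (∀ t ∈ Icc 0 T, ‖φ z t‖ ≤ ε) ∧ ‖φ z T‖ ≤ δ₁ := by
    intro z h1 h2
    refine ⟨fun t ht => ?_, ?_⟩
    · have ha := h.norm_le_section z ht.1
      have hb := hsec z.1 (h1.trans hδ₁2) t ht.1
      have hc := hρε t ht.2 ht.1
      have hd : ‖z.2‖ * Real.exp (L * t) ≤ ρ * Real.exp (L * t) := by gcongr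
      linarith
    · have ha := h.norm_le_section z hT.le
      have hb := hTδ z.1 (h1.trans hδ₁0) T le_rfl
      have hd : ‖z.2‖ * Real.exp (L * T) ≤ ρ * Real.exp (L * T) := by gcongr
      linarith
  -- The last condition keeps the second component below `ρ` as long as the orbit stays in the
  -- `ε`-ball; `|C| + 1` is a positive bound for `κ`.
  obtain ⟨δ, hδ, hδδ₁, hδε, hCδ⟩ : ∃ δ > 0, δ ≤ δ₁ ∧ δ ≤ ε ∧ (|C| + 1) * δ ≤ ρ := by
    refine ⟨min δ₁ (min ε (ρ / (|C| + 1))), by positivity, min_le_left _ _,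
      (min_le_right _ _).trans (min_le_left _ _), ?_⟩
    have : min δ₁ (min ε (ρ / (|C| + 1))) ≤ ρ / (|C| + 1) :=
      (min_le_right _ _).trans (min_le_right _ _)
    rwa [le_div_iff₀' (by positivity)] at this
  refine ⟨δ, hδ, fun z hz => ?_⟩
  have h2 : ∀ t, 0 ≤ t → (∀ s ∈ Icc 0 t, ‖φ z s‖ ≤ ε) → ‖(φ z t).2‖ ≤ ρ := by
    intro t ht hs
    refine (h.decay z t ht fun s hs' => (hs s hs').trans hεr).trans (le_trans ?_ hCδ)
    have : κ t ≤ |C| + 1 := (h.decay_le t ht).trans ((le_abs_self C).trans (by linarith))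
    gcongr
    exact (norm_snd_le z).trans hz
  have main : ∀ k : ℕ, (∀ t ∈ Icc 0 (k * T), ‖φ z t‖ ≤ ε) ∧ ‖φ z (k * T)‖ ≤ δ₁ := by
    intro k
    induction k with
    | zero =>
      refine ⟨fun t ht => ?_, ?_⟩
      · have : t = 0 := by simpa using ht
        rw [this, h.zero]; exact hz.trans hδε
      · simpa [h.zero] using hz.trans hδδ₁
    | succ k ih =>
      have hkT : 0 ≤ k * T := by positivity
      have hst := step (φ z (k * T)) ((norm_fst_le _).trans ih.2) (h2 _ hkT ih.1)
      push_cast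
      rw [add_mul, one_mul]
      refine ⟨fun t ht => ?_, ?_⟩
      · rcases le_total t (k * T) with hle | hle
        · exact ih.1 t ⟨ht.1, hle⟩
        · have := hst.1 (t - k * T) ⟨sub_nonneg.2 hle, by linarith [ht.2]⟩
          rwa [← h.add z _ _ hkT (sub_nonneg.2 hle), add_sub_cancel] at this
      · rw [h.add z _ _ hkT hT.le]
        exact hst.2
  intro t ht
  obtain ⟨k, hk⟩ := exists_nat_ge (t / T)
  exact (main k).1 t ⟨ht, (div_le_iff₀ hT).1 hk⟩

/-- After a long time `s` the second component is so small that, over one further window `T`, the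
orbit follows the section orbit into the `δ'`-ball; stability keeps it near the origin afterwards.
-/
theorem attractive [ProperSpace E₁] (h : IsCascadeFlow φ r L C κ) :
    ∃ δ > 0, ∀ z : E₁ × E₂, ‖z‖ ≤ δ → Tendsto (φ z) atTop (𝓝 0) := by
  obtain ⟨δ₀, hδ₀, hunif⟩ := h.uniform_section_attractive
  obtain ⟨δ, hδ, hstay⟩ := h.stable (lt_min h.r_pos hδ₀)
  refine ⟨δ, hδ, fun z hz => ?_⟩
  rw [Metric.tendsto_atTop]
  intro ε hε
  obtain ⟨δ', hδ', hδε⟩ := h.stable (half_pos hε)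
  obtain ⟨T, hT, hTδ⟩ := hunif (δ' / 2) (half_pos hδ')
  have hlim : Tendsto (fun s => κ s * ‖z.2‖ * Real.exp (L * T)) atTop (𝓝 0) := by
    simpa using (h.decay_lim.mul_const ‖z.2‖).mul_const (Real.exp (L * T))
  obtain ⟨s, hs, hs0⟩ :=
    ((hlim.eventually_lt_const (half_pos hδ')).and (eventually_ge_atTop 0)).exists
  have hξ : ‖(φ z s).2‖ * Real.exp (L * T) ≤ δ' / 2 := by
    refine le_trans ?_ hs.le
    gcongr
    exact h.decay z s hs0 fun t ht => (hstay z hz t ht.1).trans (min_le_left _ _)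
  have hη : ‖(φ z s).1‖ ≤ δ₀ :=
    (norm_fst_le _).trans ((hstay z hz s hs0).trans (min_le_right _ _))
  have hend : ‖φ z (s + T)‖ ≤ δ' := by
    rw [h.add z s T hs0 hT.le]
    have := h.norm_le_section (φ z s) hT.le
    have := hTδ _ hη T le_rfl
    linarith
  refine ⟨s + T, fun t ht => ?_⟩
  rw [dist_zero_right]
  have hadd := h.add z (s + T) (t - (s + T)) (by linarith) (sub_nonneg.2 ht)
  rw [add_sub_cancel] at hadd
  rw [hadd]
  exact (hδε _ hend _ (sub_nonneg.2 ht)).trans_lt (half_lt_self hε)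

end IsCascadeFlow

/-- Asymptotic stability of a cascade: if the second component of solutions decays and the dynamics
on the zero section is asymptotically stable, then so is the whole system. -/
theorem isAsymptoticallyStable_cascade [NormedSpace ℝ E₁] [NormedSpace ℝ E₂]
    [FiniteDimensional ℝ E₁] [FiniteDimensional ℝ E₂] {Z : E₁ × E₂ → E₁ × E₂} {Ω : Set (E₁ × E₂)}
    (hΩ : IsOpen Ω) (hZ : ContDiffOn ℝ 1 Z Ω)
    (hsec : ∀ η, (η, 0) ∈ Ω → (Z (η, 0)).2 = 0)
    (hzero : IsAsymptoticallyStable (fun η => (Z (η, 0)).1) {η | (η, 0) ∈ Ω} 0)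
    {C : ℝ} {κ : ℝ → ℝ} (hκC : ∀ t, 0 ≤ t → κ t ≤ C) (hκ : Tendsto κ atTop (𝓝 0))
    (hdecay : ∀ T, 0 ≤ T → ∀ z, SolvesOn Z (Icc 0 T) z → (∀ t ∈ Icc 0 T, z t ∈ Ω) →
      ‖(z T).2‖ ≤ κ T * ‖(z 0).2‖) :
    IsAsymptoticallyStable Z Ω 0 := by
  obtain ⟨h0Ω, hZ0, hstab, hattr⟩ := hzero
  have h0Ω' : (0 : E₁ × E₂) ∈ Ω := h0Ω
  obtain ⟨r, hr, hball⟩ := Metric.nhds_basis_closedBall.mem_iff.1 (hΩ.mem_nhds h0Ω')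
  have : ProperSpace E₁ := FiniteDimensional.proper_real E₁
  have : ProperSpace (E₁ × E₂) := FiniteDimensional.proper_real _
  have : CompleteSpace (E₁ × E₂) := FiniteDimensional.complete ℝ _
  -- `Y` agrees with `Z` on the closed `r`-ball and has a global Lipschitz flow `φ`, to which the
  -- results on `IsCascadeFlow` apply.
  obtain ⟨Y, L, B, V, hL, hB, hV, hKV, hVΩ, hYZ⟩ :=
    exists_lipschitzWith_eqOn hΩ hZ (isCompact_closedBall (0 : E₁ × E₂) r) hball
  choose φ hφ0 hφ using exists_solvesOn_Ici_of_lipschitzWith hL hB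
  have hYZr : ∀ z : E₁ × E₂, ‖z‖ ≤ r → Z z = Y z := fun z hz =>
    hYZ (hKV (mem_closedBall_zero_iff.2 hz))
  have hmemΩ : ∀ z : E₁ × E₂, ‖z‖ ≤ r → z ∈ Ω := fun z hz =>
    hball (mem_closedBall_zero_iff.2 hz)
  have huniq : ∀ x, SolvesOn Y (Ici 0) x → ∀ t, 0 ≤ t → x t = φ (x 0) t := fun x hx t ht =>
    SolvesOn.eqOn_of_lipschitzWith hL (hx.mono Icc_subset_Ici_self)
      ((hφ (x 0)).mono Icc_subset_Ici_self) (hφ0 (x 0)).symm ⟨ht, le_rfl⟩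
  -- Small solutions of the dynamics on the section, padded with `0`, solve the equation of `Y`; by
  -- uniqueness they are orbits of `φ`.
  have hsection : ∀ ε > 0, ∃ δ > 0, ∀ η : E₁, ‖η‖ ≤ δ → ∃ x : ℝ → E₁, x 0 = η ∧
      IsGlobalSolution (fun η => (Z (η, 0)).1) {η | (η, 0) ∈ Ω} x ∧
      ∀ t, 0 ≤ t → φ (η, 0) t = (x t, 0) ∧ ‖x t‖ ≤ ε := by
    intro ε hε
    obtain ⟨M, hM, hMε⟩ := hstab (Metric.closedBall 0 (min ε r))
      (Metric.closedBall_mem_nhds _ (lt_min hε hr))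
    obtain ⟨δ, hδ, hδM⟩ := Metric.nhds_basis_closedBall.mem_iff.1 hM
    refine ⟨δ, hδ, fun η hη => ?_⟩
    obtain ⟨⟨x, hx0, hx⟩, hxN⟩ := hMε η (hδM (mem_closedBall_zero_iff.2 hη))
    have hxr : ∀ t, 0 ≤ t → ‖x t‖ ≤ min ε r := fun t ht =>
      mem_closedBall_zero_iff.1 (hxN x hx0 hx t ht)
    have hY : SolvesOn Y (Ici 0) fun t => (x t, (0 : E₂)) := by
      intro t ht
      have h1 : ‖(x t, (0 : E₂))‖ ≤ r := by
        rw [Prod.norm_def]; simpa [hr.le] using (hxr t ht).trans (min_le_right _ _)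
      have h2 : Y (x t, 0) = ((Z (x t, 0)).1, 0) := by
        rw [← hYZr _ h1]
        exact Prod.ext rfl (hsec _ (hmemΩ _ h1))
      rw [h2]
      exact (hx t ht).2.prodMk (hasDerivWithinAt_const t _ 0)
    refine ⟨x, hx0, hx, fun t ht => ⟨?_, (hxr t ht).trans (min_le_left _ _)⟩⟩
    have := huniq _ hY t ht
    simp only [hx0] at this
    exact this.symm
  have hflow : IsCascadeFlow φ r L C κ := by
    refine ⟨hr, hφ0, fun z s t hs ht => ?_, fun z z' t ht => ?_, fun z t ht hzr => ?_, hκC, hκ,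
      fun ε hε => ?_, ?_⟩
    · have := huniq _ ((hφ z).shift hs) t ht
      simpa using this
    · have := ((hφ z).mono Icc_subset_Ici_self).dist_le hL ((hφ z').mono Icc_subset_Ici_self) t
        ⟨ht, le_rfl⟩
      rwa [hφ0, hφ0] at this
    · have := hdecay t ht (φ z) (((hφ z).mono Icc_subset_Ici_self).congr_field fun s hs =>
        (hYZr _ (hzr s hs)).symm) fun s hs => hmemΩ _ (hzr s hs)
      rwa [hφ0] at this
    · obtain ⟨δ, hδ, hη⟩ := hsection ε hε
      refine ⟨δ, hδ, fun η hηδ t ht => ?_⟩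
      obtain ⟨x, -, -, hx⟩ := hη η hηδ
      rw [(hx t ht).1, Prod.norm_def]
      simpa [hε.le] using (hx t ht).2
    · obtain ⟨M, hM, hMx⟩ := hattr
      obtain ⟨δ₁, hδ₁, hδM⟩ := Metric.nhds_basis_closedBall.mem_iff.1 hM
      obtain ⟨δ₂, hδ₂, hη⟩ := hsection 1 one_pos
      refine ⟨min δ₁ δ₂, lt_min hδ₁ hδ₂, fun η hηδ => ?_⟩
      obtain ⟨x, hx0, hx, hxt⟩ := hη η (hηδ.trans (min_le_right _ _))
      have hlim := hMx x (hx0 ▸ hδM (mem_closedBall_zero_iff.2 (hηδ.trans (min_le_left _ _)))) hx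
      have : Tendsto (fun t => (x t, (0 : E₂))) atTop (𝓝 0) :=
        hlim.prodMk_nhds tendsto_const_nhds
      refine this.congr' ?_
      filter_upwards [eventually_ge_atTop 0] with t ht using (hxt t ht).1.symm
  have hglobal : ∀ z, (∀ t, 0 ≤ t → ‖φ z t‖ ≤ r) → IsGlobalSolution Z Ω (φ z) := fun z hz t ht =>
    ⟨hmemΩ _ (hz t ht), (hYZr _ (hz t ht)) ▸ hφ z t ht⟩
  -- A given solution of `Z` is not known beforehand to stay in the `r`-ball; uniqueness for the
  -- `C¹` field on `Ω` identifies it with the orbit of `φ`.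
  have huniqZ : ∀ x, IsGlobalSolution Z Ω x → (∀ t, 0 ≤ t → ‖φ (x 0) t‖ ≤ r) →
      ∀ t, 0 ≤ t → x t = φ (x 0) t := fun x hx hxr t ht => by
    have hx' : SolvesOn Z (Ici 0) x := fun t ht => (hx t ht).2
    have hφ' : SolvesOn Z (Ici 0) (φ (x 0)) := fun t ht => (hglobal _ hxr t ht).2
    exact (hx'.mono Icc_subset_Ici_self).eqOn_of_contDiffOn hΩ hZ (hφ'.mono Icc_subset_Ici_self)
      (fun t ht => (hx t ht.1).1) (fun t ht => hmemΩ _ (hxr t ht.1)) (hφ0 _).symm ⟨ht, le_rfl⟩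
  refine ⟨h0Ω', Prod.ext hZ0 (hsec 0 h0Ω), fun N hN => ?_, ?_⟩
  · obtain ⟨ε, hε, hεN⟩ := Metric.nhds_basis_closedBall.mem_iff.1 hN
    obtain ⟨δ, hδ, hδε⟩ := hflow.stable (lt_min hε hr)
    refine ⟨Metric.closedBall 0 δ, Metric.closedBall_mem_nhds _ hδ, fun z hz => ?_⟩
    have hzr := hδε z (mem_closedBall_zero_iff.1 hz)
    have hzr' : ∀ t, 0 ≤ t → ‖φ z t‖ ≤ r := fun t ht => (hzr t ht).trans (min_le_right _ _)
    refine ⟨⟨φ z, hφ0 z, hglobal z hzr'⟩, fun x hx0 hx t ht => hεN ?_⟩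
    rw [huniqZ x hx (hx0 ▸ hzr') t ht, hx0, mem_closedBall_zero_iff]
    exact (hzr t ht).trans (min_le_left _ _)
  · obtain ⟨δ₁, hδ₁, hlim⟩ := hflow.attractive
    obtain ⟨δ₂, hδ₂, hδr⟩ := hflow.stable hr
    refine ⟨Metric.closedBall 0 (min δ₁ δ₂), Metric.closedBall_mem_nhds _ (lt_min hδ₁ hδ₂),
      fun x hx0 hx => ?_⟩
    rw [mem_closedBall_zero_iff] at hx0
    refine (hlim (x 0) (hx0.trans (min_le_left _ _))).congr' ?_
    filter_upwards [eventually_ge_atTop 0] with t ht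
    exact (huniqZ x hx (fun t ht => hδr _ (hx0.trans (min_le_right _ _)) t ht) t ht).symm

end Cascade

/-! ### Invariance of asymptotic stability under changes of coordinates. -/

section Transfer

variable {E F : Type*} [NormedAddCommGroup E] [NormedSpace ℝ E] [NormedAddCommGroup F]
  [NormedSpace ℝ F] {T : OpenPartialHomeomorph E F}

theorem hasDerivWithinAt_coord (hT : DifferentiableOn ℝ T T.source) {x : ℝ → E} {a : E}
    {J : Set ℝ} {t : ℝ} (hx : HasDerivWithinAt x a J t) (hxt : x t ∈ T.source) :
    HasDerivWithinAt (fun s => T (x s)) (fderiv ℝ T (x t) a) J t :=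
  ((hT.differentiableAt (T.open_source.mem_nhds hxt)).hasFDerivAt).comp_hasDerivWithinAt t hx

theorem fderiv_symm_fderiv (hT : DifferentiableOn ℝ T T.source)
    (hT' : DifferentiableOn ℝ T.symm T.target) {x : E} (hx : x ∈ T.source) (a : E) :
    fderiv ℝ T.symm (T x) (fderiv ℝ T x a) = a := by
  have h1 := (hT.differentiableAt (T.open_source.mem_nhds hx)).hasFDerivAt
  have h2 := (hT'.differentiableAt (T.open_target.mem_nhds (T.map_source hx))).hasFDerivAt
  have h3 : HasFDerivAt (fun y => T.symm (T y)) (ContinuousLinearMap.id ℝ E) x :=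
    (hasFDerivAt_id x).congr_of_eventuallyEq (by
      filter_upwards [T.open_source.mem_nhds hx] with y hy using T.left_inv hy)
  simpa using DFunLike.congr_fun ((h2.comp x h1).unique h3) a

theorem hasDerivWithinAt_coord_symm (hT : DifferentiableOn ℝ T T.source)
    (hT' : DifferentiableOn ℝ T.symm T.target) {z : ℝ → F} {a : E} {J : Set ℝ} {t : ℝ}
    (hzt : z t ∈ T.target) (hz : HasDerivWithinAt z (fderiv ℝ T (T.symm (z t)) a) J t) :
    HasDerivWithinAt (fun s => T.symm (z s)) a J t := by
  have h1 := ((hT'.differentiableAt (T.open_target.mem_nhds hzt)).hasFDerivAt).comp_hasDerivWithinAt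
    t hz
  have h2 := fderiv_symm_fderiv hT hT' (T.map_target hzt) a
  rw [T.right_inv hzt] at h2
  rwa [h2] at h1

/-- Asymptotic stability is invariant under a differentiable change of coordinates. -/
theorem IsAsymptoticallyStable.of_coord (hT : DifferentiableOn ℝ T T.source)
    (hT' : DifferentiableOn ℝ T.symm T.target) {X : E → E} {Z : F → F}
    (hXZ : ∀ x ∈ T.source, fderiv ℝ T x (X x) = Z (T x)) {x₀ : E} (hx₀ : x₀ ∈ T.source)
    (h : IsAsymptoticallyStable Z T.target (T x₀)) : IsAsymptoticallyStable X T.source x₀ := by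
  obtain ⟨-, hZ0, hstab, M₀, hM₀, hattr⟩ := h
  have hsource := T.open_source.mem_nhds hx₀
  have hcont : ContinuousAt T x₀ := T.continuousAt hx₀
  have hcont' : ContinuousAt T.symm (T x₀) := T.symm.continuousAt (T.map_source hx₀)
  have hfwd : ∀ x, IsGlobalSolution X T.source x → IsGlobalSolution Z T.target fun t => T (x t) :=
    fun x hx t ht => ⟨T.map_source (hx t ht).1, by
      rw [← hXZ _ (hx t ht).1]
      exact hasDerivWithinAt_coord hT (hx t ht).2 (hx t ht).1⟩
  refine ⟨hx₀, ?_, fun N hN => ?_, ?_⟩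
  · rw [← fderiv_symm_fderiv hT hT' hx₀ (X x₀), hXZ _ hx₀, hZ0, map_zero]
  · obtain ⟨M, hM, hMN⟩ := hstab (T.symm ⁻¹' N) (hcont' (by rwa [T.left_inv hx₀]))
    refine ⟨T.source ∩ T ⁻¹' M, inter_mem hsource (hcont hM), fun x hx => ⟨?_, ?_⟩⟩
    · obtain ⟨z, hz0, hz⟩ := (hMN (T x) hx.2).1
      refine ⟨fun t => T.symm (z t), by simp only [hz0, T.left_inv hx.1], fun t ht => ?_⟩
      refine ⟨T.map_target (hz t ht).1, hasDerivWithinAt_coord_symm hT hT' (hz t ht).1 ?_⟩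
      rw [hXZ _ (T.map_target (hz t ht).1), T.right_inv (hz t ht).1]
      exact (hz t ht).2
    · intro y hy0 hy t ht
      have := (hMN (T x) hx.2).2 _ (by simp only [hy0]) (hfwd y hy) t ht
      simpa only [mem_preimage, T.left_inv (hy t ht).1] using this
  · refine ⟨T ⁻¹' M₀, hcont hM₀, fun x hx0 hx => ?_⟩
    have hlim := hcont'.tendsto.comp (hattr _ hx0 (hfwd x hx))
    rw [T.left_inv hx₀] at hlim
    refine hlim.congr' ?_
    filter_upwards [eventually_ge_atTop 0] with t ht
    exact T.left_inv (hx t ht).1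

end Transfer

/-! ### Chains of integrators under Moore's feedback. -/

section Chain

/-- A solution of `ż = λ z` on an interval is an exponential. -/
theorem eq_exp_mul_of_hasDerivWithinAt {J : Set ℝ} (hJ : Convex ℝ J) (h0 : (0 : ℝ) ∈ J) {l : ℝ}
    {z : ℝ → ℝ} (hz : ∀ t ∈ J, HasDerivWithinAt z (l * z t) J t) {t : ℝ} (ht : t ∈ J) :
    z t = Real.exp (l * t) * z 0 := by
  have hd : ∀ s ∈ J, HasDerivWithinAt (fun s => Real.exp (-(l * s)) * z s) 0 J s := fun s hs => by
    have h1 : HasDerivAt (fun s : ℝ => Real.exp (-(l * s))) (Real.exp (-(l * s)) * -(l * 1)) s :=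
      ((hasDerivAt_id s).const_mul l).neg.exp
    refine (h1.hasDerivWithinAt.mul (hz s hs)).congr_deriv ?_
    ring
  have := hJ.norm_image_sub_le_of_norm_hasDerivWithin_le hd (fun _ _ => norm_zero.le) h0 ht
  rw [zero_mul] at this
  have heq := sub_eq_zero.1 (norm_le_zero_iff.1 this)
  simp only [mul_zero, neg_zero, Real.exp_zero, one_mul] at heq
  rw [← heq, ← mul_assoc, ← Real.exp_add]
  simp

variable {n : ℕ}

theorem chainA_mulVec_of_lt (x : Fin n → ℝ) (k : Fin n) (hk : (k : ℕ) + 1 < n) :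
    (chainA n *ᵥ x) k = x ⟨k + 1, hk⟩ := by
  rw [Matrix.mulVec, dotProduct, Finset.sum_eq_single ⟨k + 1, hk⟩]
  · simp [chainA]
  · intro i _ hi
    have : (i : ℕ) ≠ k + 1 := fun h => hi (Fin.ext h)
    simp [chainA, this]
  · simp

theorem chainA_mulVec_of_eq (x : Fin n → ℝ) (k : Fin n) (hk : (k : ℕ) + 1 = n) :
    (chainA n *ᵥ x) k = 0 := by
  rw [Matrix.mulVec, dotProduct]
  refine Finset.sum_eq_zero fun i _ => ?_
  have : (i : ℕ) ≠ k + 1 := by omega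
  simp [chainA, this]

theorem chainB_mulVec (u : Fin 1 → ℝ) (k : Fin n) :
    (chainB n *ᵥ u) k = if (k : ℕ) + 1 = n then u 0 else 0 := by
  simp [Matrix.mulVec, dotProduct, chainB]

theorem chainC_mulVec (x : Fin n → ℝ) (hn : 0 < n) : (chainC n *ᵥ x) 0 = x ⟨0, hn⟩ := by
  rw [Matrix.mulVec, dotProduct, Finset.sum_eq_single ⟨0, hn⟩]
  · simp [chainC]
  · intro i _ hi
    have : (i : ℕ) ≠ 0 := fun h => hi (Fin.ext h)
    simp [chainC, this]
  · simp

theorem Rosenbrock.state_eq {l : ℝ} {v : Fin n → ℝ} {b : ℝ} (h : Rosenbrock l v b) :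
    chainA n *ᵥ v + chainB n *ᵥ (fun _ => b) = l • v := by
  unfold Rosenbrock at h
  rw [Matrix.fromBlocks_mulVec] at h
  have h1 : (chainA n - l • 1) *ᵥ v + chainB n *ᵥ (fun _ => b) = 0 := by
    funext i
    simpa using congrFun h (Sum.inl i)
  rw [Matrix.sub_mulVec, Matrix.smul_mulVec, Matrix.one_mulVec] at h1
  rw [← sub_eq_zero, ← h1]
  abel

theorem Rosenbrock.output_eq {l : ℝ} {v : Fin n → ℝ} {b : ℝ} (h : Rosenbrock l v b) (hn : 0 < n) :
    v ⟨0, hn⟩ = 1 := by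
  unfold Rosenbrock at h
  rw [Matrix.fromBlocks_mulVec] at h
  rw [← chainC_mulVec v hn]
  simpa using congrFun h (Sum.inr 0)

/-- The output row gives the entry 1 at index 0, and each state row except the last reads `v (k+1) =
l * v k`. Hence `eigMatrix` is a transposed Vandermonde matrix, invertible for distinct poles. -/
theorem Rosenbrock.apply_eq_pow {l : ℝ} {v : Fin n → ℝ} {b : ℝ} (h : Rosenbrock l v b)
    (k : Fin n) : v k = l ^ (k : ℕ) := by
  obtain ⟨k, hk⟩ := k
  induction k with
  | zero => simpa using h.output_eq hk
  | succ k ih =>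
    have hk' : k < n := by omega
    have h1 := congrFun h.state_eq ⟨k, hk'⟩
    rw [Pi.add_apply, chainA_mulVec_of_lt v ⟨k, hk'⟩ hk, chainB_mulVec, if_neg (by simp; omega),
      add_zero, Pi.smul_apply, ih hk', smul_eq_mul] at h1
    rw [h1]
    exact (pow_succ' l k).symm

variable {pole : Fin n → ℝ} {v : Fin n → Fin n → ℝ} {b : Fin n → ℝ}

theorem isUnit_det_eigMatrix (hpole : StrictMono pole)
    (hros : ∀ i, Rosenbrock (pole i) (v i) (b i)) : IsUnit (eigMatrix v).det := by
  have : eigMatrix v = (Matrix.vandermonde pole)ᵀ := by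
    ext r i
    simp [eigMatrix, Matrix.vandermonde_apply, (hros i).apply_eq_pow]
  rw [this, Matrix.det_transpose, isUnit_iff_ne_zero, Matrix.det_vandermonde_ne_zero_iff]
  exact hpole.injective

theorem eigMatrix_mulVec_modal (hpole : StrictMono pole)
    (hros : ∀ i, Rosenbrock (pole i) (v i) (b i)) (z : Fin n → ℝ) :
    eigMatrix v *ᵥ modal v z = z := by
  rw [modal, Matrix.mulVec_mulVec, Matrix.mul_nonsing_inv _ (isUnit_det_eigMatrix hpole hros),
    Matrix.one_mulVec]

/-- The closed-loop matrix of the chain of integrators under Moore's feedback. -/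
noncomputable def chainClosed (v : Fin n → Fin n → ℝ) (b : Fin n → ℝ) : Matrix (Fin n) (Fin n) ℝ :=
  chainA n + chainB n * mooreGain v b

/-- As `F V = W`, column `i` of the left side is `A v_i + B b_i`, which the Rosenbrock equation
evaluates to `λ_i v_i`. -/
theorem chainClosed_mul_eigMatrix (hpole : StrictMono pole)
    (hros : ∀ i, Rosenbrock (pole i) (v i) (b i)) :
    chainClosed v b * eigMatrix v = eigMatrix v * Matrix.diagonal pole := by
  rw [chainClosed, add_mul, mooreGain, Matrix.mul_assoc, Matrix.mul_assoc,
    Matrix.nonsing_inv_mul _ (isUnit_det_eigMatrix hpole hros), Matrix.mul_one]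
  ext r i
  have := congrFun (hros i).state_eq r
  rw [Pi.add_apply, Pi.smul_apply, smul_eq_mul, mul_comm] at this
  rw [Matrix.mul_diagonal]
  exact this

theorem modal_chainClosed_mulVec (hpole : StrictMono pole)
    (hros : ∀ i, Rosenbrock (pole i) (v i) (b i)) (z : Fin n → ℝ) (i : Fin n) :
    modal v (chainClosed v b *ᵥ z) i = pole i * modal v z i := by
  have hdet := isUnit_det_eigMatrix hpole hros
  have h1 : (eigMatrix v)⁻¹ * chainClosed v b = Matrix.diagonal pole * (eigMatrix v)⁻¹ := by
    rw [← Matrix.mul_one (chainClosed v b), ← Matrix.mul_nonsing_inv _ hdet,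
      ← Matrix.mul_assoc (chainClosed v b), chainClosed_mul_eigMatrix hpole hros,
      Matrix.mul_assoc, Matrix.nonsing_inv_mul_cancel_left _ _ hdet]
  rw [modal, modal, Matrix.mulVec_mulVec, h1, ← Matrix.mulVec_mulVec, Matrix.mulVec_diagonal]

/-- Along solutions of `ż = (A + B F) z` the modal coordinates are exponentials. -/
theorem modal_eq_exp_mul (hpole : StrictMono pole)
    (hros : ∀ i, Rosenbrock (pole i) (v i) (b i)) {J : Set ℝ} (hJ : Convex ℝ J)
    (h0 : (0 : ℝ) ∈ J) {z : ℝ → Fin n → ℝ}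
    (hz : ∀ t ∈ J, HasDerivWithinAt z (chainClosed v b *ᵥ z t) J t) {t : ℝ} (ht : t ∈ J)
    (i : Fin n) : modal v (z t) i = Real.exp (pole i * t) * modal v (z 0) i := by
  refine eq_exp_mul_of_hasDerivWithinAt (z := fun t => modal v (z t) i) hJ h0 (fun s hs => ?_) ht
  rw [← modal_chainClosed_mulVec hpole hros]
  simp only [modal, Matrix.mulVec, dotProduct]
  exact HasDerivWithinAt.fun_sum fun l _ => (hasDerivWithinAt_pi.1 (hz s hs) l).const_mul _

/-- Every eigenvector has first entry 1, so the modes enter the output with the modal coordinates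
themselves as weights. -/
theorem chain_output_eq_sum (hpole : StrictMono pole)
    (hros : ∀ i, Rosenbrock (pole i) (v i) (b i)) {J : Set ℝ} (hJ : Convex ℝ J)
    (h0 : (0 : ℝ) ∈ J) {z : ℝ → Fin n → ℝ}
    (hz : ∀ t ∈ J, HasDerivWithinAt z (chainClosed v b *ᵥ z t) J t) {t : ℝ} (ht : t ∈ J)
    (hn : 0 < n) : z t ⟨0, hn⟩ = ∑ i, modal v (z 0) i * Real.exp (pole i * t) := by
  conv_lhs => rw [← eigMatrix_mulVec_modal hpole hros (z t)]
  rw [Matrix.mulVec, dotProduct]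
  refine Finset.sum_congr rfl fun i _ => ?_
  rw [modal_eq_exp_mul hpole hros hJ h0 hz ht]
  simp only [eigMatrix, Matrix.of_apply, (hros i).output_eq hn]
  ring

/-- A decay rate for the chain of integrators under Moore's feedback. -/
noncomputable def chainRate (pole : Fin n → ℝ) (v : Fin n → Fin n → ℝ) (t : ℝ) : ℝ :=
  ∑ k, ∑ i, ∑ l, |eigMatrix v k i| * Real.exp (pole i * t) * |(eigMatrix v)⁻¹ i l|

theorem chainRate_nonneg (pole : Fin n → ℝ) (v : Fin n → Fin n → ℝ) (t : ℝ) :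
    0 ≤ chainRate pole v t :=
  Finset.sum_nonneg fun _ _ => Finset.sum_nonneg fun _ _ => Finset.sum_nonneg fun _ _ => by
    positivity

theorem chainRate_le (hneg : ∀ i, pole i < 0) {t : ℝ} (ht : 0 ≤ t) :
    chainRate pole v t ≤ chainRate pole v 0 := by
  refine Finset.sum_le_sum fun k _ => Finset.sum_le_sum fun i _ => Finset.sum_le_sum fun l _ => ?_
  have : pole i * t ≤ pole i * 0 := mul_le_mul_of_nonpos_left ht (hneg i).le
  gcongr

theorem tendsto_chainRate (hneg : ∀ i, pole i < 0) :
    Tendsto (chainRate pole v) atTop (𝓝 0) := by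
  have hexp : ∀ i, Tendsto (fun t => Real.exp (pole i * t)) atTop (𝓝 0) := fun i =>
    Real.tendsto_exp_atBot.comp (tendsto_id.const_mul_atTop_of_neg (hneg i))
  have : Tendsto (chainRate pole v) atTop (𝓝 (∑ k : Fin n, ∑ i : Fin n, ∑ l : Fin n,
      |eigMatrix v k i| * 0 * |(eigMatrix v)⁻¹ i l|)) :=
    tendsto_finsetSum _ fun k _ => tendsto_finsetSum _ fun i _ => tendsto_finsetSum _ fun l _ =>
      ((hexp i).const_mul _).mul_const _
  simpa using this

/-- Here `z(t) = V exp(Λ t) V⁻¹ z(0)`, and `chainRate` adds the absolute values of all terms of this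
product, so it dominates every row. -/
theorem norm_le_chainRate (hpole : StrictMono pole)
    (hros : ∀ i, Rosenbrock (pole i) (v i) (b i)) {J : Set ℝ} (hJ : Convex ℝ J)
    (h0 : (0 : ℝ) ∈ J) {z : ℝ → Fin n → ℝ}
    (hz : ∀ t ∈ J, HasDerivWithinAt z (chainClosed v b *ᵥ z t) J t) {t : ℝ} (ht : t ∈ J) :
    ‖z t‖ ≤ chainRate pole v t * ‖z 0‖ := by
  refine (pi_norm_le_iff_of_nonneg (mul_nonneg (chainRate_nonneg _ _ _) (norm_nonneg _))).2
    fun k => ?_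
  have hle : ∑ i, ∑ l, |eigMatrix v k i| * Real.exp (pole i * t) * |(eigMatrix v)⁻¹ i l| ≤
      chainRate pole v t :=
    Finset.single_le_sum (f := fun k => ∑ i, ∑ l, |eigMatrix v k i| * Real.exp (pole i * t) *
      |(eigMatrix v)⁻¹ i l|) (fun _ _ => Finset.sum_nonneg fun _ _ => Finset.sum_nonneg
        fun _ _ => by positivity) (Finset.mem_univ k)
  refine le_trans ?_ (mul_le_mul_of_nonneg_right hle (norm_nonneg _))
  conv_lhs => rw [← eigMatrix_mulVec_modal hpole hros (z t)]
  rw [Matrix.mulVec, dotProduct, Finset.sum_mul]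
  refine (norm_sum_le _ _).trans (Finset.sum_le_sum fun i _ => ?_)
  rw [modal_eq_exp_mul hpole hros hJ h0 hz ht, modal, Matrix.mulVec, dotProduct, Finset.mul_sum,
    Finset.mul_sum, Finset.sum_mul]
  refine (norm_sum_le _ _).trans (Finset.sum_le_sum fun l _ => ?_)
  rw [norm_mul, norm_mul, norm_mul, Real.norm_eq_abs, Real.norm_eq_abs, Real.norm_eq_abs,
    Real.abs_exp, ← mul_assoc, ← mul_assoc]
  gcongr
  exact norm_le_pi_norm (z 0) l

end Chain

/-! ### The sign test for sums of exponentials. -/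

section SignTest

variable {N : ℕ}

theorem entry_castSucc (α : Fin (N + 1) → ℝ) (i : Fin N) :
    entry α ((i : ℕ) + 1) = α i.castSucc := by
  have : 1 ≤ (i : ℕ) + 1 ∧ (i : ℕ) + 1 ≤ N + 1 := by omega
  rw [entry, dif_pos this]
  rfl

theorem entry_last (α : Fin (N + 1) → ℝ) : entry α (N + 1) = α (Fin.last N) := by
  have : 1 ≤ N + 1 ∧ N + 1 ≤ N + 1 := by omega
  rw [entry, dif_pos this]
  rfl

theorem entry_neg {n : ℕ} (α : Fin n → ℝ) (k : ℕ) : entry (-α) k = -entry α k := by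
  unfold entry
  split_ifs <;> simp

theorem signTest_neg {n : ℕ} (α : Fin n → ℝ) : signTest (-α) = signTest α := by
  simp [signTest, signFlag, entry_neg]

theorem sum_signFlag (α : Fin (N + 1) → ℝ) :
    ∑ k ∈ Finset.Icc 1 N, signFlag α k * |entry α k| =
      ∑ i : Fin N, signFlag α (i + 1) * |α i.castSucc| := by
  have : Finset.Icc 1 N = (Finset.range N).image (· + 1) := by
    ext k
    simp only [Finset.mem_Icc, Finset.mem_image, Finset.mem_range]
    exact ⟨fun h => ⟨k - 1, by omega, by omega⟩, by rintro ⟨i, hi, rfl⟩; omega⟩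
  rw [this, Finset.sum_image (by simp), Finset.sum_range]
  simp only [entry_castSucc]

/-- When the last coefficient is positive, the flag marks exactly the negative coefficients: a
flagged term costs at most `|α_i| e'`, an unflagged one costs nothing. -/
theorem neg_signFlag_mul_le {α : Fin (N + 1) → ℝ} (hlast : 0 < α (Fin.last N)) (i : Fin N)
    {e e' : ℝ} (he : 0 ≤ e) (hee' : e ≤ e') :
    -(signFlag α (i + 1) * |α i.castSucc| * e') ≤ α i.castSucc * e := by
  unfold signFlag
  rw [entry_last, entry_castSucc]
  split_ifs with h
  · have hα : α i.castSucc < 0 := by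
      by_contra hcon
      exact absurd h (not_lt.2 (mul_nonneg (not_lt.1 hcon) hlast.le))
    rw [abs_of_neg hα]
    nlinarith
  · have hα : 0 ≤ α i.castSucc := by
      by_contra hcon
      exact h (mul_neg_of_neg_of_pos (not_le.1 hcon) hlast)
    simpa using mul_nonneg hα he

/-- For `t ≥ 0` the exponentials increase with the index. If `α_{n-1}` is flagged, all negative
terms are compared with the slowest exponential. If not, negative terms have index at most `n - 2`,
so the exponential of `λ_{n-1}` suffices as a bound and `α_{n-1}` counts in favour. -/
theorem sum_exp_pos_of_signTest {α pole : Fin (N + 1) → ℝ} (hpole : StrictMono pole)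
    (htest : 0 < signTest α) (hlast : 0 < α (Fin.last N)) {t : ℝ} (ht : 0 ≤ t) :
    0 < ∑ i, α i * Real.exp (pole i * t) := by
  have hexp : ∀ i j, i ≤ j → Real.exp (pole i * t) ≤ Real.exp (pole j * t) := fun i j hij =>
    Real.exp_le_exp.2 (mul_le_mul_of_nonneg_right (hpole.monotone hij) ht)
  rw [signTest, Nat.add_sub_cancel, sum_signFlag, entry_last, abs_of_pos hlast] at htest
  rw [Fin.sum_univ_castSucc]
  by_cases hflag : signFlag α N = 1
  · have h1 : -((∑ i : Fin N, signFlag α (i + 1) * |α i.castSucc|) *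
        Real.exp (pole (Fin.last N) * t)) ≤
        ∑ i : Fin N, α i.castSucc * Real.exp (pole i.castSucc * t) := by
      rw [Finset.sum_mul, ← Finset.sum_neg_distrib]
      exact Finset.sum_le_sum fun i _ =>
        neg_signFlag_mul_le hlast i (Real.exp_pos _).le (hexp _ _ (Fin.le_last _))
    rw [hflag] at htest
    have h2 : 0 < (α (Fin.last N) - ∑ i : Fin N, signFlag α (i + 1) * |α i.castSucc|) *
        Real.exp (pole (Fin.last N) * t) := mul_pos (by linarith) (Real.exp_pos _)
    linarith
  · have hflag0 : signFlag α N = 0 := by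
      unfold signFlag at hflag ⊢
      split_ifs at hflag ⊢ with h
      · exact absurd rfl hflag
      · rfl
    -- A single mode falls in this branch, since `entry α 0` has the default value `0` and the flag
    -- vanishes.
    cases N with
    | zero => simpa using mul_pos hlast (Real.exp_pos _)
    | succ M =>
      set e' := Real.exp (pole (Fin.last M).castSucc * t) with he'
      have hentry : entry α (M + 1) = α (Fin.last M).castSucc := entry_castSucc α (Fin.last M)
      have hnonneg : 0 ≤ α (Fin.last M).castSucc := by
        by_contra hcon
        have : entry α (M + 1) * entry α (M + 1 + 1) < 0 := by
          rw [hentry, entry_last]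
          exact mul_neg_of_neg_of_pos (not_le.1 hcon) hlast
        simp [signFlag, this] at hflag0
      rw [Fin.sum_univ_castSucc] at htest ⊢
      change 0 < _ - ((∑ i : Fin M, signFlag α (i + 1) * |α i.castSucc.castSucc|) +
        signFlag α (M + 1) * |α (Fin.last M).castSucc|) at htest
      rw [hflag0, hentry, abs_of_nonneg hnonneg] at htest
      have h1 : -((∑ i : Fin M, signFlag α (i + 1) * |α i.castSucc.castSucc|) * e') ≤
          ∑ i : Fin M, α i.castSucc.castSucc * Real.exp (pole i.castSucc.castSucc * t) := by
        rw [Finset.sum_mul, ← Finset.sum_neg_distrib]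
        exact Finset.sum_le_sum fun i _ =>
          neg_signFlag_mul_le hlast i.castSucc (Real.exp_pos _).le
            (hexp _ _ (Fin.castSucc_le_castSucc_iff.2 (Fin.le_last _)))
      have h2 : α (Fin.last (M + 1)) * e' ≤
          α (Fin.last (M + 1)) * Real.exp (pole (Fin.last (M + 1)) * t) :=
        mul_le_mul_of_nonneg_left (hexp _ _ (Fin.le_last _)) hlast.le
      have h3 : 0 < (α (Fin.last (M + 1)) + α (Fin.last M).castSucc -
          ∑ i : Fin M, signFlag α (i + 1) * |α i.castSucc.castSucc|) * e' :=
        mul_pos (by linarith) (Real.exp_pos _)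
      linarith

theorem sum_exp_sign_of_signTest {n : ℕ} (hn : 1 ≤ n) {α pole : Fin n → ℝ}
    (hpole : StrictMono pole) (htest : 0 < signTest α) (hlast : 3 ≤ n → entry α n ≠ 0) :
    (∀ t, 0 ≤ t → 0 < ∑ i, α i * Real.exp (pole i * t)) ∨
    (∀ t, 0 ≤ t → ∑ i, α i * Real.exp (pole i * t) < 0) := by
  obtain ⟨N, rfl⟩ : ∃ N, n = N + 1 := ⟨n - 1, by omega⟩
  rcases lt_trichotomy (α (Fin.last N)) 0 with h | h | h
  · right
    intro t ht
    have := sum_exp_pos_of_signTest (α := -α) hpole (by rwa [signTest_neg]) (by simpa using h) ht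
    simpa using this
  -- If the last coefficient is zero, all flags vanish and the test reads `|α_{n-1}| > 0`. This is
  -- impossible for one mode, and for two modes it leaves a single nonzero exponential.
  · have hlast0 : entry α (N + 1) = 0 := (entry_last α).trans h
    have hflag : ∀ k, signFlag α k = 0 := fun k => by simp [signFlag, hlast0]
    have hN : N + 1 < 3 := by
      by_contra hcon
      exact hlast (not_lt.1 hcon) hlast0
    simp only [signTest, hflag, hlast0, Nat.add_sub_cancel, zero_mul, Finset.sum_const_zero,
      abs_zero, zero_add, sub_zero, one_mul] at htest
    have hN' : N = 0 ∨ N = 1 := by omega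
    rcases hN' with rfl | rfl
    · simp [entry] at htest
    · have h1 : entry α 1 = α 0 := entry_castSucc α 0
      rw [h1] at htest
      have h2 : α 1 = 0 := h
      have hsum : ∀ t, ∑ i, α i * Real.exp (pole i * t) = α 0 * Real.exp (pole 0 * t) := fun t => by
        rw [Fin.sum_univ_two (fun i => α i * Real.exp (pole i * t)), h2, zero_mul, add_zero]
      simp only [hsum]
      rcases lt_or_gt_of_ne (abs_pos.1 htest) with h3 | h3
      · exact .inr fun t _ => mul_neg_of_neg_of_pos h3 (Real.exp_pos _)
      · exact .inl fun t _ => mul_pos h3 (Real.exp_pos _)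
  · exact .inl fun t ht => sum_exp_pos_of_signTest hpole htest h ht

end SignTest

/-! ### The closed loop in normal form. -/

namespace AffineSystem

variable {n p : ℕ} (sys : AffineSystem n p)

theorem outputLie_succ (k : ℕ) (j : Fin p) (x : Fin n → ℝ) :
    sys.outputLie (k + 1) j x = fderiv ℝ (sys.outputLie k j) x (sys.f x) :=
  congrFun (Function.iterate_succ_apply' (lieDeriv sys.f) k (sys.h j)) x

/-- The closed-loop vector field `(η, ξ) ↦ (f_o(η, ξ), (A_j ξ^j + B_j v_j)_j)` in normal form. -/
noncomputable def NormalCoordinates.normalField {sys : AffineSystem n p} {γ : Fin p → ℕ}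
    (c : sys.NormalCoordinates γ) {m : ℕ} (F : (j : Fin p) → Matrix (Fin 1) (Fin (γ j)) ℝ)
    (G : Fin p → Matrix (Fin 1) (Fin m) ℝ)
    (z : (Fin (n - ∑ j, γ j) → ℝ) × ((j : Fin p) → Fin (γ j) → ℝ)) (w : Fin m → ℝ) :
    (Fin (n - ∑ j, γ j) → ℝ) × ((j : Fin p) → Fin (γ j) → ℝ) :=
  (c.internalField z,
    fun j => chainA (γ j) *ᵥ z.2 j + chainB (γ j) *ᵥ fun _ => auxInput F G z.2 w j)

variable {sys} {γ : Fin p → ℕ} (c : sys.NormalCoordinates γ) {m : ℕ}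
  (F : (j : Fin p) → Matrix (Fin 1) (Fin (γ j)) ℝ) (G : Fin p → Matrix (Fin 1) (Fin m) ℝ)

theorem NormalCoordinates.differentiableOn : DifferentiableOn ℝ c.T c.T.source :=
  c.smooth.differentiableOn (by simp)

theorem NormalCoordinates.differentiableOn_symm : DifferentiableOn ℝ c.T.symm c.T.target :=
  c.smooth_symm.differentiableOn (by simp)

theorem fderiv_closedLoop {V : Type*} [NormedAddCommGroup V] [NormedSpace ℝ V]
    (φ : (Fin n → ℝ) → V) (u : (Fin n → ℝ) → (Fin m → ℝ) → (Fin p → ℝ)) (x : Fin n → ℝ)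
    (w : Fin m → ℝ) : fderiv ℝ φ x (sys.closedLoop u x w) =
      fderiv ℝ φ x (sys.f x) + ∑ i, u x w i • fderiv ℝ φ x (sys.g i x) := by
  simp [closedLoop]

/-- In the coordinates `(η, ξ)` the closed loop is in normal form. -/
theorem NormalCoordinates.fderiv_closedLoop_eq (hrel : sys.HasRelativeDegree γ c.T.source)
    {x : Fin n → ℝ} (hx : x ∈ c.T.source) (w : Fin m → ℝ) :
    fderiv ℝ c.T x (sys.closedLoop
      (fun x w => sys.linearizingInput γ x (auxInput F G (sys.chainCoord γ x) w)) x w) =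
      c.normalField F G (c.T x) w := by
  set u : (Fin n → ℝ) → (Fin m → ℝ) → (Fin p → ℝ) :=
    fun x w => sys.linearizingInput γ x (auxInput F G (sys.chainCoord γ x) w) with hu
  have hnhds := c.T.open_source.mem_nhds hx
  have hd := (c.differentiableOn.differentiableAt hnhds).hasFDerivAt
  refine Prod.ext ?_ ?_
  · have h1 : (fderiv ℝ c.T x (sys.closedLoop u x w)).1 =
        fderiv ℝ (fun y => (c.T y).1) x (sys.closedLoop u x w) := by
      rw [hd.fst.fderiv]; rfl
    have h2 : ∑ i, u x w i • fderiv ℝ (fun y => (c.T y).1) x (sys.g i x) = 0 :=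
      Finset.sum_eq_zero fun i _ => by rw [c.fst_inv x hx i, smul_zero]
    rw [h1, fderiv_closedLoop, h2, add_zero]
    simp only [normalField, internalField, c.T.left_inv hx]
  · funext j k
    have h1 : (fderiv ℝ c.T x (sys.closedLoop u x w)).2 j k =
        fderiv ℝ (sys.outputLie k j) x (sys.closedLoop u x w) := by
      have h2 := hasFDerivAt_pi'.1 (hasFDerivAt_pi'.1 hd.snd j) k
      have h3 : HasFDerivAt (sys.outputLie k j) _ x := h2.congr_of_eventuallyEq (by
        filter_upwards [hnhds] with y hy
        rw [c.snd_eq y hy]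
        rfl)
      rw [h3.fderiv]
      rfl
    rw [h1, fderiv_closedLoop, ← outputLie_succ]
    simp only [normalField, Pi.add_apply, chainB_mulVec]
    rw [c.snd_eq x hx]
    -- In the last row of a chain the input enters through the decoupling matrix, which the feedback
    -- inverts; in the other rows the relative degree makes the input terms vanish.
    by_cases hk : (k : ℕ) + 1 = γ j
    · rw [chainA_mulVec_of_eq _ _ hk, if_pos hk, zero_add]
      have hk' : (k : ℕ) = γ j - 1 := by omega
      have h2 : ∑ i, u x w i • fderiv ℝ (sys.outputLie k j) x (sys.g i x) =
          (sys.decoupling γ x *ᵥ u x w) j := by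
        rw [Matrix.mulVec, dotProduct]
        refine Finset.sum_congr rfl fun i _ => ?_
        rw [hk', smul_eq_mul, mul_comm]
        rfl
      rw [h2, hk, hu]
      simp only [linearizingInput]
      rw [Matrix.mulVec_add, Matrix.mulVec_neg, Matrix.mulVec_mulVec, Matrix.mulVec_mulVec,
        Matrix.mul_nonsing_inv _ (isUnit_iff_ne_zero.2 (hrel.nonsingular x hx)),
        Matrix.one_mulVec, Matrix.one_mulVec]
      simp
    · have hk' : (k : ℕ) + 1 < γ j := by have := k.2; omega
      rw [chainA_mulVec_of_lt _ _ hk', if_neg hk, add_zero, Finset.sum_eq_zero fun i _ => ?_,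
        add_zero]
      · rfl
      · rw [show fderiv ℝ (sys.outputLie k j) x (sys.g i x) = 0 from
          hrel.vanish j i k (by omega) x hx, smul_zero]

theorem NormalCoordinates.contDiffOn_internalField :
    ContDiffOn ℝ 1 c.internalField c.T.target := by
  have h1 : ContDiffOn ℝ 1 (fderiv ℝ fun y => (c.T y).1) c.T.source :=
    (contDiff_fst.comp_contDiffOn c.smooth).fderiv_of_isOpen c.T.open_source
      (show ((2 : ℕ∞) : WithTop ℕ∞) ≤ ∞ from WithTop.coe_le_coe.2 le_top)
  have h2 : ContDiffOn ℝ 1 c.T.symm c.T.target := c.smooth_symm.of_le (by simp)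
  exact (h1.comp h2 c.T.mapsTo_symm).clm_apply
    ((sys.smooth_f.of_le (by simp)).comp_contDiffOn h2)

theorem NormalCoordinates.contDiffOn_normalField :
    ContDiffOn ℝ 1 (fun q : ((Fin (n - ∑ j, γ j) → ℝ) × ((j : Fin p) → Fin (γ j) → ℝ)) ×
      (Fin m → ℝ) => c.normalField F G q.1 q.2) (c.T.target ×ˢ univ) := by
  refine (c.contDiffOn_internalField.comp contDiff_fst.contDiffOn fun q hq => hq.1).prodMk
    (ContDiff.contDiffOn ?_)
  refine contDiff_pi.2 fun j => contDiff_pi.2 fun k => ?_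
  simp only [auxInput, Pi.add_apply, Matrix.mulVec, dotProduct]
  have hξ : ∀ i l, ContDiff ℝ 1 fun q : ((Fin (n - ∑ j, γ j) → ℝ) ×
      ((j : Fin p) → Fin (γ j) → ℝ)) × (Fin m → ℝ) => q.1.2 i l := fun i l =>
    contDiff_pi.1 (contDiff_pi.1 (contDiff_snd.comp contDiff_fst) i) l
  have hw : ∀ l, ContDiff ℝ 1 fun q : ((Fin (n - ∑ j, γ j) → ℝ) ×
      ((j : Fin p) → Fin (γ j) → ℝ)) × (Fin m → ℝ) => q.2 l := fun l => contDiff_pi.1 contDiff_snd l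
  exact (ContDiff.sum fun l _ => contDiff_const.mul (hξ _ l)).add
    (ContDiff.sum fun _ _ => contDiff_const.mul
      ((ContDiff.sum fun l _ => contDiff_const.mul (hξ _ l)).add
        (ContDiff.sum fun l _ => contDiff_const.mul (hw l))))

end AffineSystem

/-- Grönwall's inequality against the zero solution. It confines `w` to a ball depending only on the
horizon, so the exosystem never causes finite escape. -/
theorem norm_le_of_solvesOn_mulVec {m : ℕ} (S : Matrix (Fin m) (Fin m) ℝ) :
    ∃ K : ℝ, 0 ≤ K ∧ ∀ (τ : ℝ) (w : ℝ → Fin m → ℝ), 0 ≤ τ → SolvesOn (S *ᵥ ·) (Icc 0 τ) w →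
      ‖w τ‖ ≤ ‖w 0‖ * Real.exp (K * τ) := by
  have hL := (LinearMap.toContinuousLinearMap (Matrix.mulVecLin S)).lipschitz
  refine ⟨‖LinearMap.toContinuousLinearMap (Matrix.mulVecLin S)‖, norm_nonneg _,
    fun τ w hτ hw => ?_⟩
  have h0 : SolvesOn (S *ᵥ ·) (Icc 0 τ) (fun _ => (0 : Fin m → ℝ)) := fun t _ => by
    simpa using hasDerivWithinAt_const t (Icc 0 τ) (0 : Fin m → ℝ)
  have := SolvesOn.dist_le (X := (S *ᵥ ·)) hL hw h0 τ ⟨hτ, le_rfl⟩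
  rwa [dist_zero_right, dist_zero_right] at this

/-! ### Responses of the closed loop: continuation, stability, tracking error. -/

namespace AffineSystem

variable {n p m : ℕ} {sys : AffineSystem n p} {γ : Fin p → ℕ} (c : sys.NormalCoordinates γ)
  {F : (j : Fin p) → Matrix (Fin 1) (Fin (γ j)) ℝ} {G : Fin p → Matrix (Fin 1) (Fin m) ℝ}
  {S : Matrix (Fin m) (Fin m) ℝ} {x₀ : Fin n → ℝ} {w₀ : Fin m → ℝ} {J : Set ℝ}
  {x : ℝ → Fin n → ℝ} {w : ℝ → Fin m → ℝ}

variable (F G) in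
/-- The feedback law `u(x, w)` with `v = F ξ + G w`. -/
noncomputable abbrev regulator (sys : AffineSystem n p) (x : Fin n → ℝ) (w : Fin m → ℝ) :
    Fin p → ℝ :=
  sys.linearizingInput γ x (auxInput F G (sys.chainCoord γ x) w)

variable {c} in
theorem IsResponse.hasDerivWithinAt_coord (hrel : sys.HasRelativeDegree γ c.T.source)
    (h : sys.IsResponse (regulator F G sys) S c.T.source x₀ w₀ J x w) {t : ℝ} (ht : t ∈ J) :
    HasDerivWithinAt (fun s => c.T (x s)) (c.normalField F G (c.T (x t)) (w t)) J t := by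
  rw [← c.fderiv_closedLoop_eq F G hrel (h.mem t ht)]
  exact NonovershootingRegulation.hasDerivWithinAt_coord c.differentiableOn (h.deriv_x t ht)
    (h.mem t ht)

/-- Solutions of the normal form yield responses of the system. -/
theorem NormalCoordinates.isResponse_of_solvesOn (hrel : sys.HasRelativeDegree γ c.T.source)
    (hx₀ : x₀ ∈ c.T.source)
    {q : ℝ → ((Fin (n - ∑ j, γ j) → ℝ) × ((j : Fin p) → Fin (γ j) → ℝ)) × (Fin m → ℝ)}
    (h0 : q 0 = (c.T x₀, w₀))
    (hq : SolvesOn (fun q => (c.normalField F G q.1 q.2, S *ᵥ q.2)) J q)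
    (hmem : ∀ t ∈ J, q t ∈ c.T.target ×ˢ (univ : Set (Fin m → ℝ))) :
    sys.IsResponse (regulator F G sys) S c.T.source x₀ w₀ J (fun t => c.T.symm (q t).1)
      (fun t => (q t).2) where
  init_x := by rw [h0, c.T.left_inv hx₀]
  init_w := by rw [h0]
  mem t ht := c.T.map_target (hmem t ht).1
  deriv_x t ht := by
    refine hasDerivWithinAt_coord_symm (z := fun t => (q t).1) c.differentiableOn
      c.differentiableOn_symm (hmem t ht).1 ?_
    rw [c.fderiv_closedLoop_eq F G hrel (c.T.map_target (hmem t ht).1),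
      c.T.right_inv (hmem t ht).1]
    exact (hasFDerivAt_fst (𝕜 := ℝ)).comp_hasDerivWithinAt t (hq t ht)
  deriv_w t ht := (hasFDerivAt_snd (𝕜 := ℝ) (p := q t)).comp_hasDerivWithinAt t (hq t ht)

/-- The response of the closed loop exists for all times unless it leaves every compact subset of
the domain. -/
theorem NormalCoordinates.continuation (hrel : sys.HasRelativeDegree γ c.T.source)
    (hx₀ : x₀ ∈ c.T.source) :
    (∃ x w, sys.IsResponse (regulator F G sys) S c.T.source x₀ w₀ (Ici 0) x w) ∨
      ∀ K ⊆ c.T.source, IsCompact K → ∃ τ ≥ 0, ∃ x w,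
        sys.IsResponse (regulator F G sys) S c.T.source x₀ w₀ (Icc 0 τ) x w ∧ x τ ∉ K := by
  refine or_iff_not_imp_right.2 fun hcon => ?_
  push Not at hcon
  obtain ⟨K, hKU, hK, hstay⟩ := hcon
  -- On the one-point interval `[0, 0]` any derivative within the interval is admissible, so
  -- constant functions form a response.
  have hx₀K : x₀ ∈ K := by
    refine hstay 0 le_rfl (fun _ => x₀) (fun _ => w₀) ⟨rfl, rfl, fun _ _ => hx₀, ?_, ?_⟩
    all_goals
      intro t ht
      exact HasFDerivWithinAt.of_subsingleton (by simp)
  set W : ((Fin (n - ∑ j, γ j) → ℝ) × ((j : Fin p) → Fin (γ j) → ℝ)) × (Fin m → ℝ) →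
      ((Fin (n - ∑ j, γ j) → ℝ) × ((j : Fin p) → Fin (γ j) → ℝ)) × (Fin m → ℝ) :=
    fun q => (c.normalField F G q.1 q.2, S *ᵥ q.2) with hW
  have hΩ : IsOpen (c.T.target ×ˢ (univ : Set (Fin m → ℝ))) := c.T.open_target.prod isOpen_univ
  have hWsmooth : ContDiffOn ℝ 1 W (c.T.target ×ˢ univ) :=
    (c.contDiffOn_normalField F G).prodMk
      ((LinearMap.toContinuousLinearMap (Matrix.mulVecLin S)).contDiff.comp contDiff_snd).contDiffOn
  obtain ⟨k, hk, hgrowth⟩ := norm_le_of_solvesOn_mulVec S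
  obtain ⟨q, hq0, hq, hqΩ⟩ := exists_solvesOn_Ici (X := W) (Ω := c.T.target ×ˢ univ)
    (z₀ := (c.T x₀, w₀)) (fun T hT => by
      have hK' : IsCompact ((c.T '' K) ×ˢ
          Metric.closedBall (0 : Fin m → ℝ) (‖w₀‖ * Real.exp (k * T))) :=
        (hK.image_of_continuousOn (c.T.continuousOn.mono hKU)).prod (isCompact_closedBall _ _)
      have hK'Ω : (c.T '' K) ×ˢ Metric.closedBall (0 : Fin m → ℝ) (‖w₀‖ * Real.exp (k * T)) ⊆
          c.T.target ×ˢ univ :=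
        prod_mono (image_subset_iff.2 fun y hy => c.T.map_source (hKU hy)) (subset_univ _)
      rcases exists_solvesOn_mem_or_exit hΩ hWsmooth hK' hK'Ω (z₀ := (c.T x₀, w₀))
        ⟨mem_image_of_mem _ hx₀K, mem_closedBall_zero_iff.2
          (le_mul_of_one_le_right (norm_nonneg _) (Real.one_le_exp (by positivity)))⟩ T with
        ⟨q, hq0, hq, hqK⟩ | ⟨τ, hτ, q, hq0, hq, hqΩ, hexit⟩
      · exact ⟨q, hq0, hq, fun t ht => hK'Ω (hqK t ht)⟩
      -- Exit is impossible in either factor: `hstay` keeps the state in `K`, and `hgrowth` keeps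
      -- `w` in the ball chosen for the horizon `T`.
      · refine absurd ⟨?_, ?_⟩ hexit
        · have := hstay τ hτ.1 _ _ (c.isResponse_of_solvesOn hrel hx₀ hq0 hq hqΩ)
          exact ⟨_, this, c.T.right_inv (hqΩ τ ⟨hτ.1, le_rfl⟩).1⟩
        · have h1 := hgrowth τ (fun t => (q t).2) hτ.1 fun t ht =>
            (hasFDerivAt_snd (𝕜 := ℝ) (p := q t)).comp_hasDerivWithinAt t (hq t ht)
          rw [mem_closedBall_zero_iff]
          refine h1.trans ?_
          simp only [hq0]
          have : k * τ ≤ k * T := mul_le_mul_of_nonneg_left hτ.2 hk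
          gcongr)
    (fun T x y hx hy hxΩ hyΩ h0 => hx.eqOn_of_contDiffOn hΩ hWsmooth hy hxΩ hyΩ h0)
  exact ⟨_, _, c.isResponse_of_solvesOn hrel hx₀ hq0 hq hqΩ⟩

variable {pole : (j : Fin p) → Fin (γ j) → ℝ} {v : (j : Fin p) → Fin (γ j) → Fin (γ j) → ℝ}
  {b : (j : Fin p) → Fin (γ j) → ℝ}

/-- With `w = 0` the origin is an asymptotically stable equilibrium of the closed loop. -/
theorem NormalCoordinates.isAsymptoticallyStable_closedLoop
    (hrel : sys.HasRelativeDegree γ c.T.source) (h0 : (0 : Fin n → ℝ) ∈ c.T.source)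
    (hT0 : c.T 0 = 0) (hzero : c.ZeroDynamicsStable) (hmono : ∀ j, StrictMono (pole j))
    (hneg : ∀ j i, pole j i < 0) (hros : ∀ j i, Rosenbrock (pole j i) (v j i) (b j i))
    (hF : ∀ j, F j = mooreGain (v j) (b j)) :
    IsAsymptoticallyStable (fun x => sys.closedLoop (regulator F G sys) x 0) c.T.source 0 := by
  -- Without `w` each chain evolves autonomously under `A_j + B_j F_j`; this gives both the
  -- invariance of the section `ξ = 0` and the decay of `ξ`.
  have hsnd : ∀ z j, (c.normalField F G z 0).2 j = chainClosed (v j) (b j) *ᵥ z.2 j := by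
    intro z j
    have : (fun _ => auxInput F G z.2 0 j) = F j *ᵥ z.2 j := by
      funext i
      rw [Subsingleton.elim i 0]
      simp [auxInput]
    simp only [normalField]
    rw [this, chainClosed, hF j, Matrix.add_mulVec, Matrix.mulVec_mulVec]
  refine IsAsymptoticallyStable.of_coord c.differentiableOn c.differentiableOn_symm
    (Z := fun z => c.normalField F G z 0) (fun x hx => c.fderiv_closedLoop_eq F G hrel hx 0) h0 ?_
  rw [hT0]
  refine isAsymptoticallyStable_cascade c.T.open_target
    ((c.contDiffOn_normalField F G).comp (contDiff_id.prodMk contDiff_const).contDiffOn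
      fun z hz => ⟨hz, mem_univ _⟩)
    (fun η _ => ?_) hzero (C := ∑ j, chainRate (pole j) (v j) 0)
    (κ := fun t => ∑ j, chainRate (pole j) (v j) t)
    (fun t ht => Finset.sum_le_sum fun j _ => chainRate_le (hneg j) ht)
    (by simpa using tendsto_finsetSum Finset.univ fun j _ => tendsto_chainRate (v := v j) (hneg j))
    fun T hT z hz hzΩ => ?_
  · funext j
    rw [hsnd]
    simp
  · have hnonneg : ∀ j ∈ Finset.univ, 0 ≤ chainRate (pole j) (v j) T := fun j _ =>
      chainRate_nonneg _ _ _
    refine (pi_norm_le_iff_of_nonneg (mul_nonneg (Finset.sum_nonneg hnonneg)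
      (norm_nonneg _))).2 fun j => ?_
    have hj : ∀ t ∈ Icc 0 T, HasDerivWithinAt (fun t => (z t).2 j)
        (chainClosed (v j) (b j) *ᵥ (z t).2 j) (Icc 0 T) t := fun t ht => by
      rw [← hsnd]
      exact hasDerivWithinAt_pi.1 ((hasFDerivAt_snd (𝕜 := ℝ)).comp_hasDerivWithinAt t (hz t ht)) j
    refine (norm_le_chainRate (hmono j) (hros j) (convex_Icc 0 T) ⟨le_rfl, hT⟩ hj
      ⟨hT, le_rfl⟩).trans ?_
    gcongr
    · exact Finset.sum_nonneg hnonneg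
    · exact Finset.single_le_sum (f := fun j => chainRate (pole j) (v j) T) hnonneg
        (Finset.mem_univ j)
    · exact norm_le_pi_norm (z 0).2 j

variable {H : Matrix (Fin p) (Fin m) ℝ} {Pi : (j : Fin p) → Matrix (Fin (γ j)) (Fin m) ℝ}
  {Gam : Fin p → Matrix (Fin 1) (Fin m) ℝ}

variable {c} in
/-- Along a response the tracking error is a sum of exponentials, whose coefficients are the modal
coordinates of the shifted initial state. -/
theorem IsResponse.trackingError_eq (hrel : sys.HasRelativeDegree γ c.T.source)
    (hSylv : ∀ j, Pi j * S = chainA (γ j) * Pi j + chainB (γ j) * Gam j)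
    (hOut : ∀ j, chainC (γ j) * Pi j = Matrix.of fun _ l => H j l)
    (hmono : ∀ j, StrictMono (pole j)) (hros : ∀ j i, Rosenbrock (pole j i) (v j i) (b j i))
    (hF : ∀ j, F j = mooreGain (v j) (b j)) (hG : ∀ j, G j = Gam j - F j * Pi j)
    (hJ : Convex ℝ J) (h0J : (0 : ℝ) ∈ J)
    (h : sys.IsResponse (regulator F G sys) S c.T.source x₀ w₀ J x w) (j : Fin p) {t : ℝ}
    (ht : t ∈ J) : sys.trackingError H x w j t =
      -∑ i, modal (v j) ((c.T x₀).2 j - Pi j *ᵥ w₀) i * Real.exp (pole j i * t) := by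
  -- With `Π S = A Π + B Γ` and `G = Γ - F Π`, the terms in `w` combine to `-(A + B F) Π w`, so the
  -- shifted state solves a homogeneous equation.
  have hd : ∀ t ∈ J, HasDerivWithinAt (fun t => (c.T (x t)).2 j - Pi j *ᵥ w t)
      (chainClosed (v j) (b j) *ᵥ ((c.T (x t)).2 j - Pi j *ᵥ w t)) J t := by
    intro t ht
    have h1 := hasDerivWithinAt_pi.1
      ((hasFDerivAt_snd (𝕜 := ℝ)).comp_hasDerivWithinAt t (h.hasDerivWithinAt_coord hrel ht)) j
    have h2 := (LinearMap.toContinuousLinearMap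
      (Matrix.mulVecLin (Pi j))).hasFDerivAt.comp_hasDerivWithinAt t (h.deriv_w t ht)
    refine (h1.sub h2).congr_deriv ?_
    have haux : (fun _ : Fin 1 => auxInput F G (c.T (x t)).2 (w t) j) =
        F j *ᵥ (c.T (x t)).2 j + G j *ᵥ w t := by
      funext i
      rw [Subsingleton.elim i 0]
      rfl
    change chainA (γ j) *ᵥ (c.T (x t)).2 j + chainB (γ j) *ᵥ
      (fun _ : Fin 1 => auxInput F G (c.T (x t)).2 (w t) j) - Pi j *ᵥ (S *ᵥ w t) = _
    rw [haux, Matrix.mulVec_mulVec, hSylv, hG, chainClosed, ← hF]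
    simp only [Matrix.mulVec_add, Matrix.add_mulVec, Matrix.mulVec_sub, Matrix.sub_mulVec,
      ← Matrix.mulVec_mulVec]
    abel
  have hpos : 0 < γ j := hrel.pos j
  have hsum := chain_output_eq_sum (hmono j) (hros j) hJ h0J hd ht hpos
  simp only [h.init_x, h.init_w] at hsum
  rw [← hsum, trackingError, c.snd_eq _ (h.mem t ht)]
  have h3 : (Pi j *ᵥ w t) ⟨0, hpos⟩ = (H *ᵥ w t) j := by
    rw [← chainC_mulVec (Pi j *ᵥ w t) hpos, Matrix.mulVec_mulVec, hOut]
    rfl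
  rw [← h3]
  exact (neg_sub _ _).symm

end AffineSystem

end NonovershootingRegulation

theorem mainTheorem1 {n p m : ℕ} (sys : AffineSystem n p)
    (S : Matrix (Fin m) (Fin m) ℝ) (H : Matrix (Fin p) (Fin m) ℝ)
    (γ : Fin p → ℕ) (c : sys.NormalCoordinates γ)
    -- the origin is an equilibrium, which corresponds to the origin of the normal form
    (hf0 : sys.f 0 = 0) (h0 : (0 : Fin n → ℝ) ∈ c.T.source) (hT0 : c.T 0 = 0)
    -- well-defined vector relative degree, nonsingular decoupling matrix
    (hrel : sys.HasRelativeDegree γ c.T.source)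
    -- stable zero dynamics
    (hzero : c.ZeroDynamicsStable)
    -- initial condition
    (x₀ : Fin n → ℝ) (hx₀ : x₀ ∈ c.T.source) (w₀ : Fin m → ℝ)
    -- solutions of the Sylvester (regulator) equations
    (Pi : (j : Fin p) → Matrix (Fin (γ j)) (Fin m) ℝ) (Gam : Fin p → Matrix (Fin 1) (Fin m) ℝ)
    (hSylv : ∀ j, Pi j * S = chainA (γ j) * Pi j + chainB (γ j) * Gam j)
    (hOut : ∀ j, chainC (γ j) * Pi j = Matrix.of fun _ l => H j l)
    -- ordered real stable closed-loop poles and the solutions of the Rosenbrock equations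
    (pole : (j : Fin p) → Fin (γ j) → ℝ)
    (hmono : ∀ j, StrictMono (pole j)) (hneg : ∀ j i, pole j i < 0)
    (v : (j : Fin p) → Fin (γ j) → Fin (γ j) → ℝ) (b : (j : Fin p) → Fin (γ j) → ℝ)
    (hros : ∀ j i, Rosenbrock (pole j i) (v j i) (b j i))
    -- the sign test on the modal coordinates of the shifted initial states
    (α : (j : Fin p) → Fin (γ j) → ℝ)
    (hα : ∀ j, α j = modal (v j) ((c.T x₀).2 j - Pi j *ᵥ w₀))
    (htest : ∀ j, 0 < signTest (α j))
    (hlast : ∀ j, 3 ≤ γ j → entry (α j) (γ j) ≠ 0)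
    -- the gains
    (F : (j : Fin p) → Matrix (Fin 1) (Fin (γ j)) ℝ) (hF : ∀ j, F j = mooreGain (v j) (b j))
    (G : Fin p → Matrix (Fin 1) (Fin m) ℝ) (hG : ∀ j, G j = Gam j - F j * Pi j) :
    sys.AchievesNonovershootingRegulation
      (fun x w => sys.linearizingInput γ x (auxInput F G (sys.chainCoord γ x) w))
      S H c.T.source x₀ w₀ := by
  have herr : ∀ (J : Set ℝ) (x : ℝ → Fin n → ℝ) (w : ℝ → Fin m → ℝ), Convex ℝ J → (0 : ℝ) ∈ J →
      sys.IsResponse (AffineSystem.regulator F G sys) S c.T.source x₀ w₀ J x w → ∀ j, ∀ t ∈ J,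
      sys.trackingError H x w j t = -∑ i, α j i * Real.exp (pole j i * t) :=
    fun J x w hJ h0J h j t ht => by
      rw [hα]
      exact h.trackingError_eq hrel hSylv hOut hmono hros hF hG hJ h0J j ht
  have hsign : ∀ (J : Set ℝ) (x : ℝ → Fin n → ℝ) (w : ℝ → Fin m → ℝ), Convex ℝ J → (0 : ℝ) ∈ J →
      J ⊆ Ici 0 → sys.IsResponse (AffineSystem.regulator F G sys) S c.T.source x₀ w₀ J x w → ∀ j,
      (∀ t ∈ J, 0 < sys.trackingError H x w j t) ∨ (∀ t ∈ J, sys.trackingError H x w j t < 0) :=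
    fun J x w hJ h0J hJ0 h j => by
      -- The error is minus the sum of exponentials, so the two alternatives are exchanged.
      rcases sum_exp_sign_of_signTest (hrel.pos j) (hmono j) (htest j) (hlast j) with hs | hs
      · exact .inr fun t ht => by
          rw [herr J x w hJ h0J h j t ht]
          exact neg_neg_of_pos (hs t (hJ0 ht))
      · exact .inl fun t ht => by
          rw [herr J x w hJ h0J h j t ht]
          exact neg_pos_of_neg (hs t (hJ0 ht))
  refine ⟨c.isAsymptoticallyStable_closedLoop hrel h0 hT0 hzero hmono hneg hros hF,
    fun τ hτ x w h => hsign _ x w (convex_Ico 0 τ) ⟨le_rfl, hτ⟩ (fun t ht => ht.1) h,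
    fun x w h j => ⟨?_, hsign _ x w (convex_Ici 0) self_mem_Ici subset_rfl h j⟩,
    c.continuation hrel hx₀⟩
  have hexp : ∀ i, Tendsto (fun t => Real.exp (pole j i * t)) atTop (𝓝 0) := fun i =>
    Real.tendsto_exp_atBot.comp (tendsto_id.const_mul_atTop_of_neg (hneg j i))
  have hlim : Tendsto (fun t => -∑ i, α j i * Real.exp (pole j i * t)) atTop
      (𝓝 (-∑ i, α j i * 0)) :=
    (tendsto_finsetSum _ fun i _ => (hexp i).const_mul (α j i)).neg
  simp only [mul_zero, Finset.sum_const_zero, neg_zero] at hlim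
  refine hlim.congr' ?_
  filter_upwards [eventually_ge_atTop 0] with t ht
  exact (herr _ x w (convex_Ici 0) self_mem_Ici h j t ht).symm
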